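/- Let $s>0$, let $N_x,N_y,N_z\ge 2$ be integers, let $\Omega=(0,N_xs)\times(0,N_ys)\times(0,N_zs)\subset\mathbb R^3$, and let $\mathcal T_h$ be the decomposition of $\Omega$ into $N_x\times N_y\times N_z$ cubes of edge length $s$. Let $V^h$ be the space of all $v\in L^2(\Omega)$ such that $v|_K$ is a polynomial of degree at most $1$ for every cube $K\in\mathcal T_h$ and the jump of $v$ across every interior face has mean value zero over that face; let $V^h_\#$ be the subspace of those $v\in V^h$ whose mean values over any two opposite faces on $\partial\Omega$ are equal. Identify nodes of $\mathcal T_h$ periodically. For a node $z$, the node-based function $\phi_z\in V^h_\#$ has value $\frac12$ at the barycenter of every face that contains $z$ (up to the identification), and $0$ at the barycenters of all other faces; $\mathfrak B$ is the set of all $\phi_z$, and $V^{\mathfrak B,h}_\#=V^h_\#\cap\operatorname{Span}\mathfrak B$. For an axis $\iota\in\{x,y,z\}$ and $1\le j\le N_\iota$ let $\Omega^\iota_j$ be the $j$-th slab of cubes perpendicular to the $\iota$-axis. For $\mu\ne\iota$ let $(\psi^\iota_j)_\mu$ denote a function in $V^h_\#$ that is supported on $\Omega^\iota_j$, whose barycenter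 values on the faces perpendicular to the $\mu$-axis of the cubes in $\Omega^\iota_j$ are $\pm1$, with alternating sign in both axis directions other than $\iota$, and whose barycenter values on all other faces are $0$ (such a function is determined up to a global sign). Put $\mathfrak A_z=\{(\psi^x_i)_z,(\psi^y_j)_z\}_{i\le N_x,\,j\le N_y}$, $\mathfrak A_x=\{(\psi^y_j)_x,(\psi^z_k)_x\}_{j\le N_y,\,k\le N_z}$, $\mathfrak A_y=\{(\psi^z_k)_y,(\psi^x_i)_y\}_{k\le N_z,\,i\le N_x}$. A complementary basis for $V^h_\#$ is a linearly independent family of functions in $V^h_\#\setminus V^{\mathfrak B,h}_\#$ such that $V^h_\#$ is the direct sum of $V^{\mathfrak B,h}_\#$ and the span of the family. 1. If $N_x,N_y,N_z$ are all even, then $V^{\mathfrak B,h}_\#\subsetneq V^h_\#$, all the functions $(\psi^\iota_j)_\mu$ exist, and, for every choice of their signs, the union of any $N_x+N_y-1$ functions from $\mathfrak A_z$, any $N_y+N_z-1$ functions from $\mathfrak A_x$ and any $N_z+N_x-1$ functions from $\mathfrak A_y$ is a complementary basis for $V^h_\#$; it has $2(N_x+N_y+N_z)-3$ elements. 2. If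 exactly one of the three numbers, $N_\iota$, is odd, and $\mu,\nu$ are the two other axes, then $V^{\mathfrak B,h}_\#\subsetneq V^h_\#$, the functions $(\psi^\iota_j)_\mu,(\psi^\iota_j)_\nu$ $(1\le j\le N_\iota)$ exist, and, for every choice of their signs, these $2N_\iota$ functions form a complementary basis for $V^h_\#$. 3. Otherwise (at least two of $N_x,N_y,N_z$ are odd), $V^{\mathfrak B,h}_\#=V^h_\#$. -/

import Mathlib

open MeasureTheory

namespace PeriodicP1NC

noncomputable section

/-! Throughout, the coordinate axes `x, y, z` are `0, 1, 2 : Fin 3`, `N ι` is the number of cells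
along the axis `ι`, and `s` is the edge length of the cubic cells. -/

/-- The rectangular domain `Ω = ∏ (0, N ι * s)`. -/
def domain (s : ℝ) (N : Fin 3 → ℕ) : Set (Fin 3 → ℝ) :=
  Set.univ.pi fun ι => Set.Ioo 0 (N ι * s)

/-- The space `L²(Ω)`. -/
abbrev L2 (s : ℝ) (N : Fin 3 → ℕ) : Type :=
  Lp ℝ 2 (volume.restrict (domain s N))

/-- The cells of the mesh, indexed (from `0`) by their position along the three axes. -/
abbrev Cell (N : Fin 3 → ℕ) : Type := ∀ ι : Fin 3, Fin (N ι)

/-- The open cube occupied by a cell. -/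
def Cell.cube (s : ℝ) {N : Fin 3 → ℕ} (K : Cell N) : Set (Fin 3 → ℝ) :=
  Set.univ.pi fun ι => Set.Ioo ((K ι : ℕ) * s) (((K ι : ℕ) + 1) * s)

/-- A two-dimensional face of the mesh: it is perpendicular to `axis`, and `s • pos` is its lowest
corner, so that it is the set of all `x` with `x axis = pos axis * s` and
`pos κ * s ≤ x κ ≤ (pos κ + 1) * s` for `κ ≠ axis`. -/
structure Face (N : Fin 3 → ℕ) where
  axis : Fin 3
  pos : Fin 3 → ℕ
  le_axis : pos axis ≤ N axis
  lt_of_ne : ∀ κ, κ ≠ axis → pos κ < N κ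

namespace Face

variable {N : Fin 3 → ℕ}

/-- `f` is one of the six faces of the cell `K`. -/
def IsFaceOf (f : Face N) (K : Cell N) : Prop :=
  (∀ κ, κ ≠ f.axis → f.pos κ = (K κ : ℕ)) ∧
    (f.pos f.axis = (K f.axis : ℕ) ∨ f.pos f.axis = (K f.axis : ℕ) + 1)

/-- `f` is an interior face. -/
def IsInterior (f : Face N) : Prop := 0 < f.pos f.axis ∧ f.pos f.axis < N f.axis

/-- `f` and `g` form a pair of boundary faces in opposite position. -/
def IsOpposite (f g : Face N) : Prop :=
  f.axis = g.axis ∧ f.pos f.axis = 0 ∧ g.pos g.axis = N g.axis ∧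
    ∀ κ, κ ≠ f.axis → f.pos κ = g.pos κ

/-- The point of the face at the distances `a`, `b` from its lowest corner along the two axes
parallel to the face. -/
def point (s : ℝ) (f : Face N) (a b : ℝ) : Fin 3 → ℝ :=
  (fun κ => (f.pos κ : ℝ) * s) + Pi.single (f.axis + 1) a + Pi.single (f.axis + 2) b

/-- The face average `|f|⁻¹ ∫_f u ds`. -/
def average (s : ℝ) (f : Face N) (u : (Fin 3 → ℝ) → ℝ) : ℝ :=
  (s ^ 2)⁻¹ * ∫ a in (0 : ℝ)..s, ∫ b in (0 : ℝ)..s, u (f.point s a b)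

/-- The barycenter of the face. -/
def barycenter (s : ℝ) (f : Face N) : Fin 3 → ℝ := f.point s (s / 2) (s / 2)

/-- The face contains the node `z`, where nodes are identified periodically: some vertex `a` of the
face agrees with `z` modulo `N`. -/
def ContainsNode (f : Face N) (z : ∀ ι : Fin 3, Fin (N ι)) : Prop :=
  ∃ a : Fin 3 → ℕ, (∀ κ, a κ % N κ = (z κ : ℕ)) ∧ a f.axis = f.pos f.axis ∧
    ∀ κ, κ ≠ f.axis → a κ = f.pos κ ∨ a κ = f.pos κ + 1

end Face

/-- `v` agrees on every cell `K` with the polynomial `p K` of degree at most one. -/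
def HasPieces (s : ℝ) {N : Fin 3 → ℕ} (v : L2 s N)
    (p : Cell N → ((Fin 3 → ℝ) →ᵃ[ℝ] ℝ)) : Prop :=
  ∀ K : Cell N, ∀ᵐ x ∂(volume.restrict (domain s N)), x ∈ K.cube s → v x = p K x

theorem HasPieces.zero (s : ℝ) (N : Fin 3 → ℕ) : HasPieces s (0 : L2 s N) 0 := by
  intro K
  filter_upwards [Lp.coeFn_zero ℝ 2 (volume.restrict (domain s N))] with x hx _
  rw [hx]
  simp

theorem HasPieces.add {s : ℝ} {N : Fin 3 → ℕ} {v w : L2 s N}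
    {p q : Cell N → ((Fin 3 → ℝ) →ᵃ[ℝ] ℝ)} (hv : HasPieces s v p) (hw : HasPieces s w q) :
    HasPieces s (v + w) (p + q) := by
  intro K
  filter_upwards [Lp.coeFn_add v w, hv K, hw K] with x hx h1 h2 hK
  rw [hx, Pi.add_apply, h1 hK, h2 hK]
  simp

theorem HasPieces.smul {s : ℝ} {N : Fin 3 → ℕ} {v : L2 s N}
    {p : Cell N → ((Fin 3 → ℝ) →ᵃ[ℝ] ℝ)} (c : ℝ) (hv : HasPieces s v p) :
    HasPieces s (c • v) (c • p) := by
  intro K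
  filter_upwards [Lp.coeFn_smul c v, hv K] with x hx h1 hK
  rw [hx, Pi.smul_apply, h1 hK]
  simp

theorem Face.average_zero (s : ℝ) {N : Fin 3 → ℕ} (f : Face N) :
    f.average s (0 : (Fin 3 → ℝ) →ᵃ[ℝ] ℝ) = 0 := by
  simp [Face.average]

theorem Face.continuous_point (s : ℝ) {N : Fin 3 → ℕ} (f : Face N) :
    Continuous fun t : ℝ × ℝ => f.point s t.1 t.2 := by
  have h1 : ∀ i : Fin 3, Continuous fun a : ℝ => (Pi.single i a : Fin 3 → ℝ) := fun i =>
    continuous_single (A := fun _ : Fin 3 => ℝ) i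
  unfold Face.point
  exact (continuous_const.add ((h1 _).comp continuous_fst)).add ((h1 _).comp continuous_snd)

theorem Face.average_add (s : ℝ) {N : Fin 3 → ℕ} (f : Face N) (p q : (Fin 3 → ℝ) →ᵃ[ℝ] ℝ) :
    f.average s (p + q : (Fin 3 → ℝ) →ᵃ[ℝ] ℝ) = f.average s p + f.average s q := by
  have hc : ∀ p : (Fin 3 → ℝ) →ᵃ[ℝ] ℝ,
      Continuous fun t : ℝ × ℝ => p (f.point s t.1 t.2) := fun p =>
    p.continuous_of_finiteDimensional.comp (f.continuous_point s)
  have hi : ∀ (p : (Fin 3 → ℝ) →ᵃ[ℝ] ℝ) (a : ℝ),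
      IntervalIntegrable (fun b => p (f.point s a b)) volume 0 s := fun p a =>
    ((hc p).comp (Continuous.prodMk_right a)).intervalIntegrable _ _
  have ho : ∀ p : (Fin 3 → ℝ) →ᵃ[ℝ] ℝ,
      IntervalIntegrable (fun a => ∫ b in (0 : ℝ)..s, p (f.point s a b)) volume 0 s := fun p =>
    (intervalIntegral.continuous_parametric_intervalIntegral_of_continuous' (hc p) _ _
      ).intervalIntegrable _ _
  simp only [Face.average, AffineMap.coe_add, Pi.add_apply]
  rw [← mul_add, ← intervalIntegral.integral_add (ho p) (ho q)]
  congr 2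
  funext a
  exact intervalIntegral.integral_add (hi p a) (hi q a)

theorem Face.average_smul (s : ℝ) {N : Fin 3 → ℕ} (f : Face N) (c : ℝ)
    (p : (Fin 3 → ℝ) →ᵃ[ℝ] ℝ) :
    f.average s (c • p : (Fin 3 → ℝ) →ᵃ[ℝ] ℝ) = c * f.average s p := by
  simp only [Face.average, AffineMap.coe_smul, Pi.smul_apply, smul_eq_mul,
    intervalIntegral.integral_const_mul]
  ring

/-- The nonconforming space `V^h`: the functions in `L²(Ω)` that are linear polynomials on each
cell and whose jump across every interior face has average zero. -/
def space (s : ℝ) (N : Fin 3 → ℕ) : Submodule ℝ (L2 s N) where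
  carrier := {v | ∃ p, HasPieces s v p ∧
    ∀ (f : Face N) (K L : Cell N), f.IsInterior → f.IsFaceOf K → f.IsFaceOf L →
      f.average s (p K) = f.average s (p L)}
  zero_mem' := ⟨0, HasPieces.zero s N, fun _ _ _ _ _ _ => rfl⟩
  add_mem' := by
    rintro v w ⟨p, hp, hp'⟩ ⟨q, hq, hq'⟩
    refine ⟨p + q, hp.add hq, fun f K L hf hK hL => ?_⟩
    rw [Pi.add_apply, Pi.add_apply, f.average_add, f.average_add, hp' f K L hf hK hL,
      hq' f K L hf hK hL]
  smul_mem' := by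
    rintro c v ⟨p, hp, hp'⟩
    refine ⟨c • p, hp.smul c, fun f K L hf hK hL => ?_⟩
    rw [Pi.smul_apply, Pi.smul_apply, f.average_smul, f.average_smul, hp' f K L hf hK hL]

/-- The periodic space `V^h_#`: the functions in `V^h` whose averages over any two opposite boundary
faces coincide. -/
def perSpace (s : ℝ) (N : Fin 3 → ℕ) : Submodule ℝ (L2 s N) where
  carrier := {v | v ∈ space s N ∧ ∃ p, HasPieces s v p ∧
    ∀ (f g : Face N) (K L : Cell N), f.IsOpposite g → f.IsFaceOf K → g.IsFaceOf L →
      f.average s (p K) = g.average s (p L)}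
  zero_mem' := ⟨zero_mem _, 0, HasPieces.zero s N, fun f g _ _ _ _ _ =>
    (f.average_zero s).trans (g.average_zero s).symm⟩
  add_mem' := by
    rintro v w ⟨hv, p, hp, hp'⟩ ⟨hw, q, hq, hq'⟩
    refine ⟨add_mem hv hw, p + q, hp.add hq, fun f g K L hf hK hL => ?_⟩
    rw [Pi.add_apply, Pi.add_apply, f.average_add, g.average_add, hp' f g K L hf hK hL,
      hq' f g K L hf hK hL]
  smul_mem' := by
    rintro c v ⟨hv, p, hp, hp'⟩
    refine ⟨Submodule.smul_mem _ c hv, c • p, hp.smul c, fun f g K L hf hK hL => ?_⟩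
    rw [Pi.smul_apply, Pi.smul_apply, f.average_smul, g.average_smul, hp' f g K L hf hK hL]

/-- `v` is piecewise linear and takes the value `m f` at the barycenter of every face `f` (seen from
each cell that has `f` as a face). -/
def HasBarycenterValues (s : ℝ) {N : Fin 3 → ℕ} (v : L2 s N) (m : Face N → ℝ) : Prop :=
  ∃ p, HasPieces s v p ∧
    ∀ (f : Face N) (K : Cell N), f.IsFaceOf K → p K (f.barycenter s) = m f

/-- `φ` is the node-based function in `V^h_#` of the periodically identified node `z`: its
barycenter value is `1/2` on the faces that contain `z`, and `0` on all others. -/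
def IsNodeBased (s : ℝ) {N : Fin 3 → ℕ} (z : ∀ ι : Fin 3, Fin (N ι)) (φ : L2 s N) : Prop :=
  φ ∈ perSpace s N ∧
    HasBarycenterValues s φ ({f : Face N | f.ContainsNode z}.indicator fun _ => 1 / 2)

/-- The space `V^{𝔅,h}_#` of all functions in `V^h_#` that lie in the span of the set `𝔅` of
node-based functions. -/
def nodeSpace (s : ℝ) (N : Fin 3 → ℕ) : Submodule ℝ (L2 s N) :=
  perSpace s N ⊓ Submodule.span ℝ {φ | ∃ z : ∀ ι : Fin 3, Fin (N ι), IsNodeBased s z φ}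

/-- The indices `⟨ι, j, μ⟩`, `μ ≠ ι`, of the alternating functions `(ψ^ι_j)_μ`; `ι` is the axis to
which the supporting slab is perpendicular, and `j` (counted from `0`) the position of the slab. -/
abbrev AltIndex (N : Fin 3 → ℕ) : Type := Σ ι : Fin 3, Fin (N ι) × {μ : Fin 3 // μ ≠ ι}

/-- `ψ` is the alternating function `(ψ^ι_j)_μ`, which is determined up to a global sign `ε`: it
lies in `V^h_#`, its barycenter values on the faces perpendicular to the `μ`-axis of the cells in
the `j`-th slab perpendicular to the `ι`-axis are `±1`, with signs alternating in both directions
`κ ≠ ι`, and its barycenter values on all other faces are `0` (so it vanishes outside the slab). -/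
def IsAlternating (s : ℝ) {N : Fin 3 → ℕ} (i : AltIndex N) (ψ : L2 s N) : Prop :=
  ψ ∈ perSpace s N ∧ ∃ ε : ℝ, (ε = 1 ∨ ε = -1) ∧
    HasBarycenterValues s ψ fun f =>
      if f.axis = i.2.2 ∧ f.pos i.1 = (i.2.1 : ℕ) then
        ε * (-1) ^ (∑ κ ∈ Finset.univ.erase i.1, f.pos κ)
      else 0

/-- The family `𝔄_μ` of the alternating functions with subscript `μ` (given by their indices). -/
def altFamily (N : Fin 3 → ℕ) (μ : Fin 3) : Finset (AltIndex N) :=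
  Finset.univ.filter fun i => (i.2.2 : Fin 3) = μ

/-- The family `b` is a complementary basis for `V` over its subspace `W`: it consists of elements
of `V` outside `W`, is linearly independent, and `V` is the direct sum of `W` and its span. -/
def IsComplementaryBasis {E : Type*} [AddCommGroup E] [Module ℝ E] (W V : Submodule ℝ E)
    {I : Type*} (b : I → E) : Prop :=
  (∀ i, b i ∈ V ∧ b i ∉ W) ∧ LinearIndependent ℝ b ∧
    Disjoint W (Submodule.span ℝ (Set.range b)) ∧ W ⊔ Submodule.span ℝ (Set.range b) = V

end

end PeriodicP1NC

/-! An affine function has face average equal to its value at the face barycenter, so a function in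
the periodic space is encoded by one number per face of the periodic mesh. On a cube the two values
on opposite faces sum to twice the value at the center. The only constraint is therefore that these
sums agree for the three axes, and `ofValues` is injective on the values satisfying it. The theorem
becomes linear algebra for `compatible N`.

Let `S_ι` be the operator f ↦ f + (f shifted one cell along ι). Compatibility reads S_0 m_0 = S_1
m_1 = S_2 m_2, and the node-based values are m_μ = ½ S_{μ+1} S_{μ+2} u. In the group algebra of the
product of the cyclic groups, S_ι is multiplication by 1 + x with x of finite order. Over ℝ this
gives A_ι, Q_ι with S_ι A_ι = 0 and A_ι + Q_ι S_ι = 1: kernel and image of S_ι are complementary,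
and A_ι is the projection onto the kernel.

Expanding m_μ with these identities for all three axes leaves a node-based part with one potential u
common to all μ, plus terms killed by S_μ and by one further S (`exists_decomposition`). Such a term
alternates along two axes. It vanishes if one of them has odd period, and otherwise is a combination
of the ψ along the remaining axis. Conversely, kernel and image meet trivially, so alternating
combinations are never node-based (`disjoint_range_nodeValues_span_altValues`).

It remains to count relations. Dividing the values with subscript μ by the full checkerboard sign
leaves functions of one coordinate each, for the two axes other than μ. These overlap only in the
constants, so each subscript carries exactly one relation. If all periods are even, one function per
subscript is dropped. With one odd period, only the ψ for that slab axis exist and no relation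
occurs among them. With two or more odd periods, none exist. -/

namespace PeriodicP1NC

/-! ### Face values and the group algebra of the periodic mesh -/

/-- Face values on the periodic mesh: `m μ K` belongs to the lower face of the cell `K` that is
perpendicular to the axis `μ`. -/
abbrev FaceValues (N : Fin 3 → ℕ) : Type := Fin 3 → Cell N → ℝ

/-- An element of a commutative real algebra with `x ^ n = 1` splits off the kernel of `1 + x`. -/
theorem exists_split_one_add {R : Type*} [CommRing R] [Algebra ℝ R] (x : R) (n : ℕ) (hn : n ≠ 0)
    (hx : x ^ n = 1) : ∃ A Q : R, (1 + x) * A = 0 ∧ A + Q * (1 + x) = 1 := by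
  have geom (k : ℕ) : (1 + x) * ∑ i ∈ Finset.range k, (-x) ^ i = 1 - (-x) ^ k := by
    simpa using mul_neg_geom_sum (-x) k
  rcases Nat.even_or_odd n with h | h
  · have hn' : (n : ℝ) ≠ 0 := by exact_mod_cast hn
    have hinv : algebraMap ℝ R (n : ℝ)⁻¹ * (n : R) = 1 := by
      rw [← map_natCast (algebraMap ℝ R) n, ← map_mul, inv_mul_cancel₀ hn', map_one]
    -- Here (-x)^n = 1, and A is the mean of the powers of -x. Then 1 - A is the mean of the terms 1
    -- - (-x)^k, each divisible by 1 + x.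
    refine ⟨algebraMap ℝ R (n : ℝ)⁻¹ * ∑ i ∈ Finset.range n, (-x) ^ i,
      algebraMap ℝ R (n : ℝ)⁻¹ * ∑ k ∈ Finset.range n, ∑ i ∈ Finset.range k, (-x) ^ i, ?_, ?_⟩
    · rw [mul_left_comm, geom, h.neg_pow, hx, sub_self, mul_zero]
    · have : (∑ k ∈ Finset.range n, ∑ i ∈ Finset.range k, (-x) ^ i) * (1 + x)
          = n - ∑ i ∈ Finset.range n, (-x) ^ i := by
        rw [mul_comm, Finset.mul_sum, Finset.sum_congr rfl fun k _ => geom k,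
          Finset.sum_sub_distrib]
        simp
      rw [mul_assoc, this, mul_sub, hinv]
      ring
  · have h2 : algebraMap ℝ R (2 : ℝ)⁻¹ * 2 = 1 := by
      rw [← map_ofNat (algebraMap ℝ R) 2, ← map_mul, inv_mul_cancel₀ two_ne_zero, map_one]
    -- Here (-x)^n = -1, so the geometric sum times 1 + x equals 2: the element 1 + x is a unit and
    -- its kernel is trivial.
    refine ⟨0, algebraMap ℝ R (2 : ℝ)⁻¹ * ∑ i ∈ Finset.range n, (-x) ^ i, mul_zero _, ?_⟩
    rw [mul_assoc, mul_comm _ (1 + x), geom, h.neg_pow, hx, sub_neg_eq_add, one_add_one_eq_two, h2,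
      zero_add]

/-- Since TB = UC = 0, the terms in p and q vanish after multiplication by TU. They are kept so that
the bracket is symmetric in the three axes and can serve as a common potential. The rest of TU(...)
is (1-B)(1-C)m. In the remainder, Bm = ABm and Cm = ACm, because Sm is divisible by T and by U and
is thus killed by B and by C. -/
theorem split_component {R : Type*} [CommRing R] {S T U A B C P Q W m p q : R}
    (hB : T * B = 0) (hC : U * C = 0)
    (hP : A + P * S = 1) (hQ : B + Q * T = 1) (hW : C + W * U = 1)
    (hp : S * m = T * p) (hq : S * m = U * q) :
    m = T * U * (P * Q * W * (S * m) + A * Q * W * m + B * W * P * p + C * P * Q * q)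
      + A * C * m + A * (1 - C) * B * m := by
  have eA : A = 1 - P * S := by linear_combination hP
  have eB : Q * T = 1 - B := by linear_combination hQ
  have eC : W * U = 1 - C := by linear_combination hW
  have h1 : B * (S * m) = 0 := by rw [hp]; linear_combination p * hB
  have h2 : C * (S * m) = 0 := by rw [hq]; linear_combination q * hC
  have e1 : T * U * (P * Q * W * (S * m) + A * Q * W * m + B * W * P * p + C * P * Q * q)
      = (1 - B) * (1 - C) * (P * S + A) * m := by
    linear_combination (W * U * (P * S + A) * m) * eB + ((1 - B) * (P * S + A) * m) * eC
      + U * W * P * p * hB + T * P * Q * q * hC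
  rw [e1]
  linear_combination (-m) * hP + P * h1 + P * h2 - P * C * h1

/-- The element f + g is killed by ST and lies in the image of ST. The splittings make kernel and
image of S, and likewise of T, intersect trivially, which removes the two factors one after the
other. -/
theorem eq_zero_of_split_pair {R : Type*} [CommRing R] {S T A B P Q f g u : R}
    (hA : S * A = 0) (hB : T * B = 0) (hP : A + P * S = 1) (hQ : B + Q * T = 1)
    (hf : S * f = 0) (hg : T * g = 0) (h : f + g = S * T * u) : f + g = 0 := by
  linear_combination (-(f + g)) * hQ - (f + g) * (Q * T) * hP + P * Q * T * hf + P * Q * S * hg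
    + (B + A * Q * T) * h + u * S * hB + u * T * Q * T * hA

section

variable {N : Fin 3 → ℕ}

/-- Cell functions as elements of the group algebra of the periodic mesh. -/
noncomputable def toAlgebra (N : Fin 3 → ℕ) :
    (Cell N → ℝ) ≃ AddMonoidAlgebra ℝ (Cell N) :=
  Finsupp.equivFunOnFinite.symm.trans AddMonoidAlgebra.coeffEquiv.symm

theorem coeff_toAlgebra (f : Cell N → ℝ) (K : Cell N) : (toAlgebra N f).coeff K = f K := rfl

theorem toAlgebra_add (f g : Cell N → ℝ) :
    toAlgebra N (f + g) = toAlgebra N f + toAlgebra N g := by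
  ext K; simp [coeff_toAlgebra]

theorem toAlgebra_zero : toAlgebra N 0 = 0 := by
  ext K; simp [coeff_toAlgebra]

variable [∀ ι, NeZero (N ι)]

/-- The unit step along the axis `ι` on the periodic mesh. -/
def step (ι : Fin 3) : Cell N := Pi.single ι 1

theorem card_nsmul_step (ι : Fin 3) : N ι • (step ι : Cell N) = 0 := by
  funext κ
  rcases eq_or_ne κ ι with rfl | h
  · have := card_nsmul_eq_zero' (x := (1 : Fin (N κ)))
    simpa [step] using this
  · simp [step, h]

/-- The sum of a cell function over two neighbouring cells along the axis `ι`. -/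
noncomputable def pairSum (ι : Fin 3) : (Cell N → ℝ) →ₗ[ℝ] (Cell N → ℝ) where
  toFun f K := f K + f (K + step ι)
  map_add' f g := by funext K; simp only [Pi.add_apply]; ring
  map_smul' c f := by funext K; simp only [Pi.smul_apply, smul_eq_mul, RingHom.id_apply]; ring

theorem pairSum_apply (ι : Fin 3) (f : Cell N → ℝ) (K : Cell N) :
    pairSum ι f K = f K + f (K + step ι) := rfl

/-- The group algebra element that acts as `pairSum ι`. -/
noncomputable def pairElement (N : Fin 3 → ℕ) [∀ ι, NeZero (N ι)] (ι : Fin 3) :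
    AddMonoidAlgebra ℝ (Cell N) := 1 + AddMonoidAlgebra.single (-step ι) 1

theorem toAlgebra_pairSum (ι : Fin 3) (f : Cell N → ℝ) :
    toAlgebra N (pairSum ι f) = pairElement N ι * toAlgebra N f := by
  ext K
  rw [pairElement, add_mul, one_mul, AddMonoidAlgebra.coeff_add, Finsupp.add_apply,
    coeff_toAlgebra, coeff_toAlgebra, pairSum_apply,
    AddMonoidAlgebra.coeff_single_mul_eq_mul_coeff (m₂ := K + step ι), one_mul, coeff_toAlgebra]
  intro d _
  rw [neg_add_eq_iff_eq_add, add_comm]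

theorem exists_pairElement_split (N : Fin 3 → ℕ) [∀ ι, NeZero (N ι)] (ι : Fin 3) :
    ∃ A Q, pairElement N ι * A = 0 ∧ A + Q * pairElement N ι = 1 := by
  refine exists_split_one_add _ (N ι) (NeZero.ne _) ?_
  rw [AddMonoidAlgebra.single_pow, one_pow, smul_neg, card_nsmul_step, neg_zero]
  rfl

/-- The face values of the functions in the periodic space: the sums
over opposite faces of a cell do not depend on the axis. -/
def compatible (N : Fin 3 → ℕ) [∀ ι, NeZero (N ι)] : Submodule ℝ (FaceValues N) where
  carrier := {m | ∀ μ ν, pairSum μ (m μ) = pairSum ν (m ν)}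
  zero_mem' := by intro μ ν; simp
  add_mem' := by
    intro m n hm hn μ ν
    rw [Pi.add_apply, Pi.add_apply, map_add, map_add, hm μ ν, hn μ ν]
  smul_mem' := by
    intro c m hm μ ν
    rw [Pi.smul_apply, Pi.smul_apply, map_smul, map_smul, hm μ ν]

/-- The face values of the combination of node-based functions with given coefficients. -/
noncomputable def nodeValues (N : Fin 3 → ℕ) [∀ ι, NeZero (N ι)] :
    (Cell N → ℝ) →ₗ[ℝ] FaceValues N :=
  LinearMap.pi fun μ => (1 / 2 : ℝ) • (pairSum (μ + 1) ∘ₗ pairSum (μ + 2))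

theorem nodeValues_apply (u : Cell N → ℝ) (μ : Fin 3) :
    nodeValues N u μ = (1 / 2 : ℝ) • pairSum (μ + 1) (pairSum (μ + 2) u) := rfl

theorem pairSum_comm (ι κ : Fin 3) (f : Cell N → ℝ) :
    pairSum ι (pairSum κ f) = pairSum κ (pairSum ι f) := by
  funext K
  simp only [pairSum_apply, add_right_comm K (step ι) (step κ)]
  ring

theorem nodeValues_mem (u : Cell N → ℝ) : nodeValues N u ∈ compatible N := by
  have h (μ : Fin 3) : pairSum μ (nodeValues N u μ)
      = (1 / 2 : ℝ) • pairSum 0 (pairSum 1 (pairSum 2 u)) := by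
    rw [nodeValues_apply, map_smul]
    congr 1
    fin_cases μ
    · rfl
    · change pairSum 1 (pairSum 2 (pairSum 0 u)) = _
      rw [pairSum_comm 2 0, pairSum_comm 1 0]
    · change pairSum 2 (pairSum 0 (pairSum 1 u)) = _
      rw [pairSum_comm 2 0, pairSum_comm 2 1]
  intro μ ν
  rw [h, h]

/-- Compatible face values are node-based up to parts that alternate along two axes. -/
theorem exists_decomposition {m : FaceValues N} (hm : m ∈ compatible N) :
    ∃ (u : Cell N → ℝ) (f g : FaceValues N), ∀ μ, m μ = nodeValues N u μ + f μ + g μ ∧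
      pairSum μ (f μ) = 0 ∧ pairSum (μ + 2) (f μ) = 0 ∧
      pairSum μ (g μ) = 0 ∧ pairSum (μ + 1) (g μ) = 0 := by
  choose A Q hA hQ using exists_pairElement_split N
  have hm' (μ ν) : pairElement N μ * toAlgebra N (m μ) = pairElement N ν * toAlgebra N (m ν) := by
    rw [← toAlgebra_pairSum, ← toAlgebra_pairSum, hm μ ν]
  let a (μ : Fin 3) := toAlgebra N (m μ)
  -- This is the bracket of `split_component`. It is invariant under rotating the axes because S_μ
  -- m_μ does not depend on μ, so one potential serves all three components.
  let u₀ := Q 0 * Q 1 * Q 2 * (pairElement N 0 * a 0) + A 0 * Q 1 * Q 2 * a 0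
    + A 1 * Q 0 * Q 2 * a 1 + A 2 * Q 0 * Q 1 * a 2
  have hrot (μ : Fin 3) : u₀ = Q μ * Q (μ + 1) * Q (μ + 2) * (pairElement N μ * a μ)
      + A μ * Q (μ + 1) * Q (μ + 2) * a μ + A (μ + 1) * Q (μ + 2) * Q μ * a (μ + 1)
      + A (μ + 2) * Q μ * Q (μ + 1) * a (μ + 2) := by
    rw [show pairElement N μ * a μ = pairElement N 0 * a 0 from hm' μ 0]
    fin_cases μ
    · change _ = Q 0 * Q 1 * Q 2 * _ + A 0 * Q 1 * Q 2 * a 0 + A 1 * Q 2 * Q 0 * a 1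
        + A 2 * Q 0 * Q 1 * a 2
      ring
    · change _ = Q 1 * Q 2 * Q 0 * _ + A 1 * Q 2 * Q 0 * a 1 + A 2 * Q 0 * Q 1 * a 2
        + A 0 * Q 1 * Q 2 * a 0
      ring
    · change _ = Q 2 * Q 0 * Q 1 * _ + A 2 * Q 0 * Q 1 * a 2 + A 0 * Q 1 * Q 2 * a 0
        + A 1 * Q 2 * Q 0 * a 1
      ring
  have hu (μ : Fin 3) : a μ = pairElement N (μ + 1) * (pairElement N (μ + 2) * u₀)
      + A μ * A (μ + 2) * a μ + A μ * (1 - A (μ + 2)) * A (μ + 1) * a μ := by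
    have key := split_component (hA (μ + 1)) (hA (μ + 2)) (hQ μ) (hQ (μ + 1)) (hQ (μ + 2))
      (hm' μ (μ + 1)) (hm' μ (μ + 2))
    rw [hrot μ]
    linear_combination key
  have kill (ι : Fin 3) (b : AddMonoidAlgebra ℝ (Cell N)) (hb : pairElement N ι * b = 0) :
      pairSum ι ((toAlgebra N).symm b) = 0 := by
    apply (toAlgebra N).injective
    rw [toAlgebra_pairSum, Equiv.apply_symm_apply, hb, toAlgebra_zero]
  -- The factor 2 cancels the barycenter value ½ in `nodeValues`.
  refine ⟨(2 : ℝ) • (toAlgebra N).symm u₀,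
    fun μ => (toAlgebra N).symm (A μ * A (μ + 2) * a μ),
    fun μ => (toAlgebra N).symm (A μ * (1 - A (μ + 2)) * A (μ + 1) * a μ),
    fun μ => ⟨?_, kill _ _ ?_, kill _ _ ?_, kill _ _ ?_, kill _ _ ?_⟩⟩
  · rw [map_smul, Pi.smul_apply, nodeValues_apply, smul_smul, mul_one_div_cancel two_ne_zero,
      one_smul]
    apply (toAlgebra N).injective
    rw [toAlgebra_add, toAlgebra_add, toAlgebra_pairSum, toAlgebra_pairSum,
      Equiv.apply_symm_apply, Equiv.apply_symm_apply, Equiv.apply_symm_apply]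
    exact hu μ
  · linear_combination (A (μ + 2) * a μ) * hA μ
  · linear_combination (A μ * a μ) * hA (μ + 2)
  · linear_combination ((1 - A (μ + 2)) * A (μ + 1) * a μ) * hA μ
  · linear_combination (A μ * (1 - A (μ + 2)) * a μ) * hA (μ + 1)

/-- The sum of two alternating parts that is node-based vanishes. -/
theorem add_eq_zero_of_eq_pairSum {ι κ : Fin 3} {f g u : Cell N → ℝ} (hf : pairSum ι f = 0)
    (hg : pairSum κ g = 0) (h : f + g = pairSum ι (pairSum κ u)) : f + g = 0 := by
  obtain ⟨A, P, hA, hP⟩ := exists_pairElement_split N ι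
  obtain ⟨B, Q, hB, hQ⟩ := exists_pairElement_split N κ
  apply (toAlgebra N).injective
  rw [toAlgebra_add, toAlgebra_zero]
  refine eq_zero_of_split_pair hA hB hP hQ ?_ ?_ (u := toAlgebra N u) ?_
  · rw [← toAlgebra_pairSum, hf, toAlgebra_zero]
  · rw [← toAlgebra_pairSum, hg, toAlgebra_zero]
  · rw [← toAlgebra_add, h, toAlgebra_pairSum, toAlgebra_pairSum, mul_assoc]

end

end PeriodicP1NC

/-! ### Alternating face values: their relation, their span, and independence from node-based values
-/

namespace PeriodicP1NC

theorem neg_one_pow_mod_of_even {n : ℕ} (hn : Even n) (m : ℕ) :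
    (-1 : ℝ) ^ (m % n) = (-1) ^ m := by
  conv_rhs => rw [← Nat.div_add_mod m n, pow_add, pow_mul, hn.neg_one_pow, one_pow, one_mul]

theorem neg_one_pow_mul_self (n : ℕ) : (-1 : ℝ) ^ n * (-1) ^ n = 1 := by
  rw [← mul_pow]; simp

section

variable {N : Fin 3 → ℕ}

/-- The sign `±1` alternating along both axes other than `ι`. -/
noncomputable def altSign (ι : Fin 3) (K : Cell N) : ℝ :=
  (-1) ^ ∑ κ ∈ Finset.univ.erase ι, (K κ : ℕ)

theorem altSign_mul_self (ι : Fin 3) (K : Cell N) : altSign ι K * altSign ι K = 1 :=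
  neg_one_pow_mul_self _

theorem altSign_eq (ι : Fin 3) (K : Cell N) :
    altSign ι K = (-1) ^ (K ι : ℕ) * (-1) ^ ∑ κ, (K κ : ℕ) := by
  rw [altSign, ← Finset.add_sum_erase _ _ (Finset.mem_univ ι), pow_add, ← mul_assoc,
    neg_one_pow_mul_self, one_mul]

/-- The face values of the alternating function with index `i`, up to sign. -/
noncomputable def altValues (i : AltIndex N) : FaceValues N := fun μ K =>
  if μ = i.2.2 ∧ K i.1 = i.2.1 then altSign i.1 K else 0

theorem altValues_eq_zero {i : AltIndex N} {μ : Fin 3} (h : μ ≠ i.2.2) : altValues i μ = 0 := by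
  funext K
  simp [altValues, h]

/-- The meshes on which the alternating function with index `i` exists. -/
def AltIndex.Admissible (i : AltIndex N) : Prop := ∀ κ, κ ≠ i.1 → Even (N κ)

/-- The values of a combination of alternating functions. -/
theorem sum_smul_altValues_apply (c : AltIndex N → ℝ) (μ : Fin 3) (K : Cell N) :
    (∑ i, c i • altValues i) μ K =
      ∑ ι : {ι : Fin 3 // μ ≠ ι}, c ⟨ι, K ι, μ, ι.2⟩ * altSign ι.1 K := by
  rw [Finset.sum_apply, Finset.sum_apply]
  symm
  refine Finset.sum_of_injOn (fun ι => (⟨ι, K ι, μ, ι.2⟩ : AltIndex N)) ?_ (by simp) ?_ ?_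
  · intro ι _ κ _ h
    exact Subtype.ext (congrArg Sigma.fst h)
  · rintro ⟨ι, j, ν, hν⟩ _ h
    simp only [Pi.smul_apply, altValues, smul_eq_mul]
    rw [if_neg, mul_zero]
    rintro ⟨h1, h2⟩
    subst h1 h2
    exact h ⟨⟨ι, hν⟩, by simp, rfl⟩
  · intro ι _
    simp [altValues]

theorem ne_add_one (μ : Fin 3) : μ ≠ μ + 1 := by revert μ; decide

theorem ne_add_two (μ : Fin 3) : μ ≠ μ + 2 := by revert μ; decide

theorem add_one_ne_add_two (μ : Fin 3) : μ + 1 ≠ μ + 2 := by revert μ; decide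

theorem exists_third_axis (μ ι : Fin 3) : ∃ κ, μ ≠ κ ∧ κ ≠ ι := by
  revert μ ι; decide

theorem eq_add_one_or_eq_add_two {μ ι : Fin 3} (h : μ ≠ ι) : ι = μ + 1 ∨ ι = μ + 2 := by
  revert μ ι; decide

theorem sum_subtype_ne {M : Type*} [AddCommMonoid M] (μ : Fin 3) (h : {ι : Fin 3 // μ ≠ ι} → M) :
    ∑ ι, h ι = h ⟨μ + 1, ne_add_one μ⟩ + h ⟨μ + 2, ne_add_two μ⟩ := by
  have huniv : (Finset.univ : Finset {ι : Fin 3 // μ ≠ ι}) =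
      {⟨μ + 1, ne_add_one μ⟩, ⟨μ + 2, ne_add_two μ⟩} := by
    clear h
    revert μ; decide
  rw [huniv, Finset.sum_pair]
  clear h huniv
  revert μ; decide

/-- A vanishing combination of alternating functions is trivial if one coefficient vanishes for
each subscript. -/
theorem eq_zero_of_sum_smul_altValues_eq_zero [∀ ι, NeZero (N ι)] {c : AltIndex N → ℝ}
    (hc : ∑ i, c i • altValues i = 0)
    (hmiss : ∀ μ : Fin 3, ∃ i : AltIndex N, (i.2.2 : Fin 3) = μ ∧ c i = 0) : c = 0 := by
  -- After removal of the full checkerboard sign, the relation ties each coefficient for the axis μ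
  -- + 1 to each one for μ + 2. A single vanishing coefficient therefore forces all others with
  -- subscript μ to vanish. Admissibility plays no role.
  have h (μ : Fin 3) (a : Fin (N (μ + 1))) (b : Fin (N (μ + 2))) :
      c ⟨μ + 1, a, μ, ne_add_one μ⟩ * (-1) ^ (a : ℕ)
        + c ⟨μ + 2, b, μ, ne_add_two μ⟩ * (-1) ^ (b : ℕ) = 0 := by
    let K : Cell N := Function.update (Function.update 0 (μ + 1) a) (μ + 2) b
    have ha : K (μ + 1) = a := by simp [K]
    have hb : K (μ + 2) = b := by simp [K]
    have hK := congrFun (congrFun hc μ) K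
    rw [sum_smul_altValues_apply, sum_subtype_ne, altSign_eq, altSign_eq] at hK
    simp only [ha, hb, Pi.zero_apply] at hK
    have hs := neg_one_pow_mul_self (∑ κ, (K κ : ℕ))
    linear_combination (-1) ^ (∑ κ, (K κ : ℕ)) * hK
      - (c ⟨μ + 1, a, μ, ne_add_one μ⟩ * (-1) ^ (a : ℕ)
        + c ⟨μ + 2, b, μ, ne_add_two μ⟩ * (-1) ^ (b : ℕ)) * hs
  have hne (n : ℕ) : (-1 : ℝ) ^ n ≠ 0 := pow_ne_zero _ (by norm_num)
  have hzero (μ : Fin 3) : (∀ a, c ⟨μ + 1, a, μ, ne_add_one μ⟩ = 0) ∧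
      ∀ b, c ⟨μ + 2, b, μ, ne_add_two μ⟩ = 0 := by
    obtain ⟨⟨ι, j, ν, hν⟩, rfl, hi⟩ := hmiss μ
    rcases eq_add_one_or_eq_add_two hν with rfl | rfl
    · have h2 : ∀ b, c ⟨ν + 2, b, ν, ne_add_two ν⟩ = 0 := fun b => by
        simpa [hi, hne] using h ν j b
      exact ⟨fun a => by simpa [h2, hne] using h ν a 0, h2⟩
    · have h1 : ∀ a, c ⟨ν + 1, a, ν, ne_add_one ν⟩ = 0 := fun a => by
        simpa [hi, hne] using h ν a j
      exact ⟨h1, fun b => by simpa [h1, hne] using h ν 0 b⟩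
  funext ⟨ι, j, ν, hν⟩
  rcases eq_add_one_or_eq_add_two hν with rfl | rfl
  exacts [(hzero ν).1 j, (hzero ν).2 j]

/-- The alternating functions with a common subscript satisfy one linear relation. -/
theorem sum_neg_one_pow_smul_altValues (ι κ μ : Fin 3) (hι : μ ≠ ι) (hκ : μ ≠ κ) :
    ∑ j : Fin (N ι), (-1 : ℝ) ^ (j : ℕ) • altValues (⟨ι, j, μ, hι⟩ : AltIndex N) =
      ∑ j : Fin (N κ), (-1 : ℝ) ^ (j : ℕ) • altValues (⟨κ, j, μ, hκ⟩ : AltIndex N) := by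
  -- The signs (-1)^j restore the missing alternation along ι, so both sums are the full
  -- checkerboard on the faces perpendicular to μ.
  have key (ι : Fin 3) (hι : μ ≠ ι) :
      ∑ j : Fin (N ι), (-1 : ℝ) ^ (j : ℕ) • altValues (⟨ι, j, μ, hι⟩ : AltIndex N) =
        Pi.single μ fun K => (-1 : ℝ) ^ ∑ κ, (K κ : ℕ) := by
    funext ν K
    rw [Finset.sum_apply, Finset.sum_apply]
    rcases eq_or_ne ν μ with rfl | hν
    · rw [Finset.sum_eq_single (K ι), Pi.single_eq_same]
      · simp [altValues, altSign_eq, ← mul_assoc, neg_one_pow_mul_self]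
      · intro j _ hj
        simp [altValues, hj.symm]
      · simp
    · simp [altValues, hν]
  rw [key, key]

/-- An alternating function is a combination of the others with the same subscript. -/
theorem altValues_mem_span_of_omits_one {I : Type*} {e : I → AltIndex N} {i : AltIndex N}
    (h : ∀ k : AltIndex N, (k.2.2 : Fin 3) = i.2.2 → k ≠ i → k ∈ Set.range e) :
    altValues i ∈ Submodule.span ℝ (Set.range fun k => altValues (e k)) := by
  obtain ⟨ι, j, μ, hμ⟩ := i
  obtain ⟨κ, hκ, hικ⟩ : ∃ κ, μ ≠ κ ∧ κ ≠ ι := exists_third_axis μ ι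
  have mem (k : AltIndex N) (hk : (k.2.2 : Fin 3) = μ) (hne : k ≠ ⟨ι, j, μ, hμ⟩) :
      altValues k ∈ Submodule.span ℝ (Set.range fun k => altValues (e k)) := by
    obtain ⟨l, rfl⟩ := h k hk hne
    exact Submodule.subset_span ⟨l, rfl⟩
  have rel := sum_neg_one_pow_smul_altValues (N := N) ι κ μ hμ hκ
  rw [← Finset.add_sum_erase _ _ (Finset.mem_univ j), ← eq_sub_iff_add_eq] at rel
  have : altValues (⟨ι, j, μ, hμ⟩ : AltIndex N) = (-1 : ℝ) ^ (j : ℕ) •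
      ((-1 : ℝ) ^ (j : ℕ) • altValues (⟨ι, j, μ, hμ⟩ : AltIndex N)) := by
    rw [smul_smul, neg_one_pow_mul_self, one_smul]
  rw [this, rel]
  refine Submodule.smul_mem _ _ (sub_mem ?_ ?_)
  · exact Submodule.sum_mem _ fun l _ => Submodule.smul_mem _ _ <| mem _ rfl fun hl =>
      hικ (congrArg Sigma.fst hl)
  · refine Submodule.sum_mem _ fun l hl => Submodule.smul_mem _ _ <| mem _ rfl fun h' => ?_
    have := eq_of_heq (Sigma.mk.inj h').2
    exact Finset.ne_of_mem_erase hl (congrArg Prod.fst this)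

variable [∀ ι, NeZero (N ι)]

/-- Evenness is what makes the sign flip also across the periodic boundary. -/
theorem altSign_add_step {ι κ : Fin 3} (h : κ ≠ ι) (hκ : Even (N κ)) (K : Cell N) :
    altSign ι (K + step κ) = -altSign ι K := by
  have hm : κ ∈ Finset.univ.erase ι := by simp [h]
  unfold altSign
  rw [← Finset.add_sum_erase _ _ hm, ← Finset.add_sum_erase _ (fun κ => (K κ : ℕ)) hm, pow_add,
    pow_add, ← neg_mul]
  congr 1
  · have h2 : 1 < N κ := by
      have := NeZero.ne (N κ)
      obtain ⟨k, hk⟩ := hκ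
      omega
    rw [Pi.add_apply, step, Pi.single_eq_same, Fin.val_add, neg_one_pow_mod_of_even hκ, pow_add,
      Fin.val_one', Nat.mod_eq_of_lt h2, pow_one, mul_neg_one]
  · congr 1
    refine Finset.sum_congr rfl fun τ hτ => ?_
    rw [Pi.add_apply, step, Pi.single_eq_of_ne (Finset.ne_of_mem_erase hτ), add_zero]

theorem pairSum_altValues {i : AltIndex N} (hi : i.Admissible) {κ : Fin 3} (hκ : κ ≠ i.1)
    (μ : Fin 3) : pairSum κ (altValues i μ) = 0 := by
  funext K
  rw [pairSum_apply]
  have : (K + step κ : Cell N) i.1 = K i.1 := by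
    rw [Pi.add_apply, step, Pi.single_eq_of_ne hκ.symm, add_zero]
  simp only [altValues, this, altSign_add_step hκ (hi κ hκ)]
  split_ifs <;> simp

theorem altValues_mem {i : AltIndex N} (hi : i.Admissible) : altValues i ∈ compatible N := by
  have h (μ : Fin 3) : pairSum μ (altValues i μ) = 0 := by
    rcases eq_or_ne μ i.2.2 with rfl | hμ
    · exact pairSum_altValues hi i.2.2.2 _
    · rw [altValues_eq_zero hμ, map_zero]
  intro μ ν
  rw [h, h]

/-- Going once around the period returns to the same cell after an odd number of sign changes. -/
theorem eq_zero_of_pairSum_eq_zero_of_odd {ι : Fin 3} (hι : Odd (N ι)) {f : Cell N → ℝ}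
    (hf : pairSum ι f = 0) : f = 0 := by
  have hstep (n : ℕ) (K : Cell N) : f (K + n • step ι) = (-1) ^ n * f K := by
    induction n with
    | zero => simp
    | succ n ih =>
      have := congrFun hf (K + n • step ι)
      rw [pairSum_apply, Pi.zero_apply, ih] at this
      rw [succ_nsmul, ← add_assoc, pow_succ]
      linear_combination this
  funext K
  have := hstep (N ι) K
  rw [card_nsmul_step, add_zero, hι.neg_one_pow] at this
  rw [Pi.zero_apply]
  linarith

theorem eq_neg_one_pow_mul_update {ι : Fin 3} {f : Cell N → ℝ} (hf : pairSum ι f = 0)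
    (K : Cell N) : f K = (-1) ^ (K ι : ℕ) * f (Function.update K ι 0) := by
  obtain ⟨k, hk⟩ : ∃ k, (K ι : ℕ) = k := ⟨_, rfl⟩
  induction k generalizing K with
  | zero =>
    have : Function.update K ι 0 = K := by
      rw [Function.update_eq_self_iff]
      exact Fin.ext (by simp [hk])
    rw [this, hk, pow_zero, one_mul]
  | succ k ih =>
    have hlt : k + 1 < N ι := hk ▸ (K ι).2
    let K' : Cell N := Function.update K ι ⟨k, by omega⟩
    have hK' : K' + step ι = K := by
      funext κ
      rcases eq_or_ne κ ι with rfl | h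
      · refine Fin.ext ?_
        simp only [Pi.add_apply, K', step, Function.update_self, Pi.single_eq_same, Fin.val_add,
          Fin.val_one']
        rw [Nat.mod_eq_of_lt (a := 1) (by omega), Nat.mod_eq_of_lt hlt, hk]
      · simp [K', step, h]
    have h1 := ih K' (by simp [K'])
    have h2 := congrFun hf K'
    rw [pairSum_apply, hK', h1, Pi.zero_apply] at h2
    simp only [K', Function.update_self, Function.update_idem] at h2
    rw [hk, pow_succ]
    linear_combination h2

/-- Each coordinate other than ι can be moved to 0 at the cost of a sign, so such a function is
determined by its values along one line of cells parallel to ι. -/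
theorem eq_altSign_mul {ι : Fin 3} {f : Cell N → ℝ} (hf : ∀ κ, κ ≠ ι → pairSum κ f = 0)
    (K : Cell N) : f K = altSign ι K * f (Pi.single ι (K ι)) := by
  have h (t : Finset (Fin 3)) (ht : ι ∉ t) :
      f K = (-1) ^ (∑ κ ∈ t, (K κ : ℕ)) * f (t.piecewise 0 K) := by
    induction t using Finset.induction_on with
    | empty => simp
    | insert κ t hκ ih =>
      rw [Finset.mem_insert, not_or] at ht
      rw [ih ht.2, eq_neg_one_pow_mul_update (hf κ (Ne.symm ht.1)), Finset.sum_insert hκ,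
        Finset.piecewise_insert, Finset.piecewise_eq_of_notMem _ _ _ hκ, pow_add, Pi.zero_apply]
      ring
  rw [h _ (Finset.notMem_erase ι Finset.univ), altSign]
  congr 2
  funext κ
  rcases eq_or_ne κ ι with rfl | hκ
  · simp
  · simp [hκ]

theorem single_mem_span_altValues {ι μ : Fin 3} (hμ : μ ≠ ι) {f : Cell N → ℝ}
    (hf : ∀ κ, κ ≠ ι → pairSum κ f = 0) :
    (Pi.single μ f : FaceValues N) ∈
      Submodule.span ℝ (altValues '' {i : AltIndex N | i.Admissible}) := by
  by_cases hodd : ∃ κ, κ ≠ ι ∧ Odd (N κ)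
  · obtain ⟨κ, hκ, ho⟩ := hodd
    rw [eq_zero_of_pairSum_eq_zero_of_odd ho (hf κ hκ), Pi.single_zero]
    exact zero_mem _
  · have hadm : ∀ κ, κ ≠ ι → Even (N κ) := fun κ hκ => by
      rw [← Nat.not_odd_iff_even]
      exact fun ho => hodd ⟨κ, hκ, ho⟩
    have : (Pi.single μ f : FaceValues N) =
        ∑ j : Fin (N ι), f (Pi.single ι j) • altValues (⟨ι, j, μ, hμ⟩ : AltIndex N) := by
      funext ν K
      rw [Finset.sum_apply, Finset.sum_apply]
      rcases eq_or_ne ν μ with rfl | hν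
      · rw [Finset.sum_eq_single (K ι), Pi.single_eq_same, eq_altSign_mul hf]
        · simp [altValues, mul_comm]
        · intro j _ hj
          simp [altValues, hj.symm]
        · simp
      · simp [altValues, hν]
    rw [this]
    exact Submodule.sum_mem _ fun j _ => Submodule.smul_mem _ _
      (Submodule.subset_span ⟨⟨ι, j, μ, hμ⟩, hadm, rfl⟩)

/-- The compatible face values are spanned by the node-based and the alternating ones. -/
theorem compatible_le : compatible N ≤ LinearMap.range (nodeValues N) ⊔
    Submodule.span ℝ (altValues '' {i : AltIndex N | i.Admissible}) := by
  intro m hm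
  obtain ⟨u, f, g, h⟩ := exists_decomposition hm
  have : m = nodeValues N u + ∑ μ, ((Pi.single μ (f μ) : FaceValues N) + Pi.single μ (g μ)) := by
    rw [Finset.sum_add_distrib, Finset.univ_sum_single, Finset.univ_sum_single]
    funext μ
    rw [(h μ).1, Pi.add_apply, Pi.add_apply, add_assoc]
  rw [this]
  have cover (μ κ : Fin 3) :
      (κ ≠ μ + 1 → κ = μ ∨ κ = μ + 2) ∧ (κ ≠ μ + 2 → κ = μ ∨ κ = μ + 1) := by
    revert μ κ; decide
  refine Submodule.add_mem_sup ⟨u, rfl⟩ (Submodule.sum_mem _ fun μ _ => add_mem ?_ ?_)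
  · refine single_mem_span_altValues (ne_add_one μ) fun κ hκ => ?_
    rcases (cover μ κ).1 hκ with rfl | rfl
    exacts [(h _).2.1, (h μ).2.2.1]
  · refine single_mem_span_altValues (ne_add_two μ) fun κ hκ => ?_
    rcases (cover μ κ).2 hκ with rfl | rfl
    exacts [(h _).2.2.2.1, (h μ).2.2.2.2]

/-- Slab functions for the axis μ + 1 alternate along μ + 2, and all others along μ + 1. This puts
the component μ into the form required by `add_eq_zero_of_eq_pairSum`. -/
theorem exists_add_of_mem_span_altValues {m : FaceValues N}
    (hm : m ∈ Submodule.span ℝ (altValues '' {i : AltIndex N | i.Admissible})) (μ : Fin 3) :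
    ∃ f g, m μ = f + g ∧ pairSum (μ + 1) f = 0 ∧ pairSum (μ + 2) g = 0 := by
  induction hm using Submodule.span_induction with
  | mem m hm =>
    obtain ⟨i, hi, rfl⟩ := hm
    by_cases h : μ + 1 = i.1
    · refine ⟨0, altValues i μ, (zero_add _).symm, map_zero _, pairSum_altValues hi ?_ μ⟩
      rw [← h]
      exact (add_one_ne_add_two μ).symm
    · exact ⟨altValues i μ, 0, (add_zero _).symm, pairSum_altValues hi h μ, map_zero _⟩
  | zero => exact ⟨0, 0, by simp⟩
  | add m n _ _ hm hn =>
    obtain ⟨f, g, h, hf, hg⟩ := hm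
    obtain ⟨f', g', h', hf', hg'⟩ := hn
    refine ⟨f + f', g + g', ?_, by rw [map_add, hf, hf', add_zero],
      by rw [map_add, hg, hg', add_zero]⟩
    rw [Pi.add_apply, h, h', add_add_add_comm]
  | smul c m _ hm =>
    obtain ⟨f, g, h, hf, hg⟩ := hm
    refine ⟨c • f, c • g, ?_, by rw [map_smul, hf, smul_zero], by rw [map_smul, hg, smul_zero]⟩
    rw [Pi.smul_apply, h, smul_add]

theorem disjoint_range_nodeValues_span_altValues :
    Disjoint (LinearMap.range (nodeValues N))
      (Submodule.span ℝ (altValues '' {i : AltIndex N | i.Admissible})) := by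
  rw [Submodule.disjoint_def]
  rintro _ ⟨u, rfl⟩ hu
  funext μ
  obtain ⟨f, g, h, hf, hg⟩ := exists_add_of_mem_span_altValues hu μ
  rw [h]
  refine add_eq_zero_of_eq_pairSum hf hg (u := (1 / 2 : ℝ) • u) ?_
  rw [← h, nodeValues_apply, map_smul, map_smul]

/-- Face values version of the complementary basis property, for a family of alternating functions
that spans all the admissible ones and omits one index for each subscript. -/
theorem isComplementaryBasis_altValues {I : Type*} {e : I → AltIndex N}
    (he : Function.Injective e) (hadm : ∀ i, (e i).Admissible)
    (hmiss : ∀ μ : Fin 3, ∃ i : AltIndex N, (i.2.2 : Fin 3) = μ ∧ i ∉ Set.range e)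
    (hspan : ∀ i : AltIndex N, i.Admissible →
      altValues i ∈ Submodule.span ℝ (Set.range fun k => altValues (e k)))
    {ε : I → ℝ} (hε : ∀ i, ε i = 1 ∨ ε i = -1) :
    IsComplementaryBasis (LinearMap.range (nodeValues N)) (compatible N)
      fun i => ε i • altValues (e i) := by
  have hε0 (i : I) : ε i ≠ 0 := by rcases hε i with h | h <;> rw [h] <;> norm_num
  have hli : LinearIndependent ℝ fun i => altValues (e i) := by
    have : Fintype I := Fintype.ofInjective e he
    rw [Fintype.linearIndependent_iff]
    intro c hc i
    -- The coefficients are extended by 0 to all indices. The omitted index for each subscript then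
    -- supplies the vanishing coefficient.
    have h0 : Function.extend e c 0 = 0 := by
      refine eq_zero_of_sum_smul_altValues_eq_zero ?_ fun μ => ?_
      · rw [← hc]
        symm
        refine Finset.sum_of_injOn e he.injOn (by simp) ?_ ?_
        · intro i _ hi
          rw [Function.extend_apply' _ _ _ fun ⟨k, hk⟩ => hi ⟨k, by simp, hk⟩, Pi.zero_apply,
            zero_smul]
        · intro i _
          rw [he.extend_apply]
      · obtain ⟨i, hi, hr⟩ := hmiss μ
        exact ⟨i, hi, Function.extend_apply' _ _ _ hr⟩
    simpa [he.extend_apply] using congrFun h0 (e i)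
  have hliε : LinearIndependent ℝ fun i => ε i • altValues (e i) :=
    hli.units_smul fun i => Units.mk0 (ε i) (hε0 i)
  have hrange : Submodule.span ℝ (Set.range fun i => ε i • altValues (e i)) =
      Submodule.span ℝ (altValues '' {i : AltIndex N | i.Admissible}) := by
    apply le_antisymm
    · rw [Submodule.span_le]
      rintro _ ⟨i, rfl⟩
      exact Submodule.smul_mem _ _ (Submodule.subset_span ⟨e i, hadm i, rfl⟩)
    · rw [Submodule.span_le]
      rintro _ ⟨i, hi, rfl⟩
      refine Submodule.span_le.mpr ?_ (hspan i hi)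
      rintro _ ⟨k, rfl⟩
      have : altValues (e k) = (ε k)⁻¹ • (ε k • altValues (e k)) := by
        rw [smul_smul, inv_mul_cancel₀ (hε0 k), one_smul]
      rw [SetLike.mem_coe]
      dsimp only
      rw [this]
      exact Submodule.smul_mem _ _ (Submodule.subset_span ⟨k, rfl⟩)
  have hdisj := disjoint_range_nodeValues_span_altValues (N := N)
  refine ⟨fun i => ⟨Submodule.smul_mem _ _ (altValues_mem (hadm i)), fun hi => hliε.ne_zero i ?_⟩,
    hliε, hrange ▸ hdisj, ?_⟩
  · exact Submodule.disjoint_def.mp hdisj _ hi (hrange ▸ Submodule.subset_span ⟨i, rfl⟩)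
  · rw [hrange]
    refine le_antisymm (sup_le ?_ (Submodule.span_le.mpr ?_)) compatible_le
    · rintro _ ⟨u, rfl⟩
      exact nodeValues_mem u
    · rintro _ ⟨i, hi, rfl⟩
      exact altValues_mem hi

end

end PeriodicP1NC

/-! ### Cells, faces and piecewise affine functions in L² -/

namespace PeriodicP1NC

section

variable {N : Fin 3 → ℕ}

/-- The barycenter of a cell. -/
noncomputable def Cell.center (s : ℝ) (K : Cell N) : Fin 3 → ℝ := fun κ => (K κ : ℕ) * s + s / 2

theorem affineMap_apply_add (q : (Fin 3 → ℝ) →ᵃ[ℝ] ℝ) (x v : Fin 3 → ℝ) :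
    q (x + v) = q x + ∑ κ, v κ * q.linear (Pi.single κ 1) := by
  have := q.map_vadd x v
  rw [vadd_eq_add, vadd_eq_add, add_comm v x] at this
  rw [this, add_comm, LinearMap.pi_apply_eq_sum_univ q.linear v]
  simp only [smul_eq_mul]
  congr 2
  funext κ
  congr 2
  funext τ
  simp [Pi.single_apply, eq_comm]

theorem affineMap_apply_add_single (q : (Fin 3 → ℝ) →ᵃ[ℝ] ℝ) (x : Fin 3 → ℝ) (κ : Fin 3) (a : ℝ) :
    q (x + Pi.single κ a) = q x + a * q.linear (Pi.single κ 1) := by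
  rw [affineMap_apply_add, Finset.sum_eq_single κ, Pi.single_eq_same]
  · intro τ _ hτ
    rw [Pi.single_eq_of_ne hτ, zero_mul]
  · simp

/-- This turns the integral conditions defining the spaces into equalities of point values. -/
theorem Face.average_eq_barycenter {s : ℝ} (hs : s ≠ 0) (f : Face N) (q : (Fin 3 → ℝ) →ᵃ[ℝ] ℝ) :
    f.average s q = q (f.barycenter s) := by
  have hq (a b : ℝ) : q (f.point s a b) = q (fun κ => (f.pos κ : ℝ) * s)
      + a * q.linear (Pi.single (f.axis + 1) 1) + b * q.linear (Pi.single (f.axis + 2) 1) := by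
    rw [Face.point, affineMap_apply_add_single, affineMap_apply_add_single]
  have hint (α β : ℝ) : ∫ b in (0 : ℝ)..s, (α + b * β) = s * α + s ^ 2 / 2 * β := by
    rw [intervalIntegral.integral_add (by simp) (by apply Continuous.intervalIntegrable; fun_prop)]
    simp
  have hint' (α β γ : ℝ) : ∫ b in (0 : ℝ)..s, (s * (α + b * β) + γ) =
      s * (s * α + s ^ 2 / 2 * β) + s * γ := by
    rw [intervalIntegral.integral_add (by apply Continuous.intervalIntegrable; fun_prop) (by simp),
      intervalIntegral.integral_const_mul, hint]
    simp
  rw [Face.average, Face.barycenter, hq]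
  simp only [hq, hint, hint']
  field_simp

theorem Face.barycenter_apply (s : ℝ) (f : Face N) (κ : Fin 3) :
    f.barycenter s κ = f.pos κ * s + if κ = f.axis then 0 else s / 2 := by
  have axes : ∀ κ μ : Fin 3, (κ = μ + 1 → κ ≠ μ ∧ κ ≠ μ + 2) ∧ (κ = μ + 2 → κ ≠ μ ∧ κ ≠ μ + 1) ∧
      (κ ≠ μ → κ = μ + 1 ∨ κ = μ + 2) := by decide
  obtain ⟨h1, h2, h3⟩ := axes κ f.axis
  simp only [Face.barycenter, Face.point, Pi.add_apply, Pi.single_apply]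
  by_cases h : κ = f.axis
  · rw [if_neg fun h' => (h1 h').1 h, if_neg fun h' => (h2 h').1 h, if_pos h]
    ring
  · rcases h3 h with h' | h'
    · rw [if_pos h', if_neg (h1 h').2, if_neg h, add_zero]
    · rw [if_neg (h2 h').2, if_pos h', if_neg h, add_zero]

theorem Face.barycenter_eq_sub {s : ℝ} {f : Face N} {K : Cell N} (h : f.IsFaceOf K)
    (h0 : f.pos f.axis = (K f.axis : ℕ)) :
    f.barycenter s = K.center s + Pi.single f.axis (-(s / 2)) := by
  funext κ
  rw [f.barycenter_apply, Pi.add_apply, Cell.center]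
  by_cases hκ : κ = f.axis
  · subst hκ
    rw [if_pos rfl, h0, Pi.single_eq_same]
    ring
  · rw [if_neg hκ, h.1 κ hκ, Pi.single_eq_of_ne hκ, add_zero]

theorem Face.barycenter_eq_add {s : ℝ} {f : Face N} {K : Cell N} (h : f.IsFaceOf K)
    (h0 : f.pos f.axis = (K f.axis : ℕ) + 1) :
    f.barycenter s = K.center s + Pi.single f.axis (s / 2) := by
  funext κ
  rw [f.barycenter_apply, Pi.add_apply, Cell.center]
  by_cases hκ : κ = f.axis
  · subst hκ
    rw [if_pos rfl, h0, Pi.single_eq_same]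
    push_cast
    ring
  · rw [if_neg hκ, h.1 κ hκ, Pi.single_eq_of_ne hκ, add_zero]

/-- The lower face of a cell along an axis. -/
def Cell.lowerFace (K : Cell N) (μ : Fin 3) : Face N where
  axis := μ
  pos κ := K κ
  le_axis := (K μ).2.le
  lt_of_ne κ _ := (K κ).2

/-- The upper face of a cell along an axis. -/
def Cell.upperFace (K : Cell N) (μ : Fin 3) : Face N where
  axis := μ
  pos κ := K κ + if κ = μ then 1 else 0
  le_axis := by simp
  lt_of_ne κ hκ := by simp [hκ]

theorem Cell.isFaceOf_lowerFace (K : Cell N) (μ : Fin 3) : (K.lowerFace μ).IsFaceOf K :=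
  ⟨fun _ _ => rfl, Or.inl rfl⟩

theorem Cell.isFaceOf_upperFace (K : Cell N) (μ : Fin 3) : (K.upperFace μ).IsFaceOf K :=
  ⟨fun κ hκ => by simpa [upperFace] using hκ, Or.inr (by simp [upperFace])⟩

theorem Cell.cube_subset_domain {s : ℝ} (hs : 0 < s) (K : Cell N) : K.cube s ⊆ domain s N := by
  intro x hx ι _
  have h := hx ι (Set.mem_univ ι)
  have hK : ((K ι : ℕ) : ℝ) + 1 ≤ N ι := by exact_mod_cast (K ι).2
  exact ⟨lt_of_le_of_lt (by positivity) h.1,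
    h.2.trans_le (mul_le_mul_of_nonneg_right hK hs.le)⟩

theorem Cell.isOpen_cube (s : ℝ) (K : Cell N) : IsOpen (K.cube s) :=
  isOpen_set_pi Set.finite_univ fun _ _ => isOpen_Ioo

theorem Cell.center_mem_cube {s : ℝ} (hs : 0 < s) (K : Cell N) : K.center s ∈ K.cube s := by
  intro ι _
  constructor <;> simp only [Cell.center] <;> linarith

theorem Cell.eq_of_mem_cube {s : ℝ} (hs : 0 < s) {K L : Cell N} {x : Fin 3 → ℝ}
    (hK : x ∈ K.cube s) (hL : x ∈ L.cube s) : K = L := by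
  have key (K L : Cell N) (hK : x ∈ K.cube s) (hL : x ∈ L.cube s) (ι : Fin 3) :
      (K ι : ℕ) ≤ L ι := by
    have h := ((hK ι (Set.mem_univ ι)).1.trans (hL ι (Set.mem_univ ι)).2)
    have := lt_of_mul_lt_mul_right h hs.le
    exact Nat.lt_succ_iff.mp (by exact_mod_cast this)
  funext ι
  exact Fin.ext (le_antisymm (key K L hK hL ι) (key L K hL hK ι))

/-- The grid planes are null sets; off them, the cell is found by rounding down x / s. -/
theorem ae_exists_mem_cube {s : ℝ} (hs : 0 < s) (N : Fin 3 → ℕ) :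
    ∀ᵐ x ∂(volume.restrict (domain s N)), ∃ K : Cell N, x ∈ K.cube s := by
  have hdom : MeasurableSet (domain s N) :=
    (isOpen_set_pi Set.finite_univ fun _ _ => isOpen_Ioo).measurableSet
  have hplane : ∀ᵐ x : Fin 3 → ℝ, ∀ (ι : Fin 3) (k : ℕ), x ι ≠ k * s := by
    rw [ae_all_iff]
    intro ι
    rw [ae_all_iff]
    intro k
    have := Measure.pi_hyperplane (fun _ : Fin 3 => (volume : Measure ℝ)) ι ((k : ℝ) * s)
    rw [← volume_pi] at this
    rw [ae_iff]
    simpa using this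
  rw [ae_restrict_iff' hdom]
  filter_upwards [hplane] with x hx hxd
  have hk (ι : Fin 3) : ∃ k : Fin (N ι), ((k : ℕ) : ℝ) * s < x ι ∧ x ι < ((k : ℕ) + 1) * s := by
    obtain ⟨h0, h1⟩ := hxd ι (Set.mem_univ ι)
    have hle := Nat.floor_le (div_pos h0 hs).le
    have hlt := Nat.lt_floor_add_one (x ι / s)
    rw [le_div_iff₀ hs] at hle
    rw [div_lt_iff₀ hs] at hlt
    have hN : ⌊x ι / s⌋₊ < N ι := by
      rw [Nat.floor_lt (div_pos h0 hs).le, div_lt_iff₀ hs]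
      exact h1
    exact ⟨⟨_, hN⟩, lt_of_le_of_ne hle (hx ι _).symm, hlt⟩
  choose K hK using hk
  exact ⟨K, fun ι _ => hK ι⟩

theorem HasPieces.eq {s : ℝ} (hs : 0 < s) {v w : L2 s N} {p : Cell N → ((Fin 3 → ℝ) →ᵃ[ℝ] ℝ)}
    (hv : HasPieces s v p) (hw : HasPieces s w p) : v = w := by
  apply Lp.ext
  filter_upwards [ae_exists_mem_cube hs N, ae_all_iff.mpr hv, ae_all_iff.mpr hw] with x hx h1 h2
  obtain ⟨K, hK⟩ := hx
  rw [h1 K hK, h2 K hK]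

/-- Affine maps that agree almost everywhere on a nonempty open cube agree everywhere. Hence the
pieces witnessing the interior and the periodic conditions are the same. -/
theorem HasPieces.unique {s : ℝ} (hs : 0 < s) {v : L2 s N}
    {p q : Cell N → ((Fin 3 → ℝ) →ᵃ[ℝ] ℝ)} (hp : HasPieces s v p) (hq : HasPieces s v q) :
    p = q := by
  funext K
  have hae : (p K : (Fin 3 → ℝ) → ℝ) =ᵐ[volume.restrict (K.cube s)] q K := by
    have h := (hp K).and (hq K)
    have h' := ae_restrict_of_ae_restrict_of_subset (K.cube_subset_domain hs) h
    have hmem := ae_restrict_mem (μ := volume) (K.isOpen_cube s).measurableSet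
    filter_upwards [h', hmem] with x hx hxK
    rw [← hx.1 hxK, hx.2 hxK]
  have heq : Set.EqOn (p K) (q K) (K.cube s) :=
    Measure.eqOn_open_of_ae_eq hae (K.isOpen_cube s)
      (p K).continuous_of_finiteDimensional.continuousOn
      (q K).continuous_of_finiteDimensional.continuousOn
  exact AffineMap.ext_on ((K.isOpen_cube s).affineSpan_eq_top ⟨_, K.center_mem_cube hs⟩) heq

theorem memLp_affineMap (s : ℝ) (N : Fin 3 → ℕ) (q : (Fin 3 → ℝ) →ᵃ[ℝ] ℝ) :
    MemLp q 2 (volume.restrict (domain s N)) := by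
  have hc := q.continuous_of_finiteDimensional
  have hsub : domain s N ⊆ Set.Icc 0 fun ι => N ι * s := fun x hx =>
    ⟨fun ι => (hx ι (Set.mem_univ ι)).1.le, fun ι => (hx ι (Set.mem_univ ι)).2.le⟩
  have hdom : MeasurableSet (domain s N) :=
    (isOpen_set_pi Set.finite_univ fun _ _ => isOpen_Ioo).measurableSet
  have : IsFiniteMeasure (volume.restrict (domain s N)) := by
    constructor
    rw [Measure.restrict_apply_univ]
    exact (measure_mono hsub).trans_lt isCompact_Icc.measure_lt_top
  obtain ⟨C, hC⟩ := isCompact_Icc.exists_bound_of_continuousOn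
    (hc.continuousOn (s := Set.Icc 0 fun ι => (N ι : ℝ) * s))
  refine MemLp.of_bound hc.aestronglyMeasurable C ?_
  filter_upwards [ae_restrict_mem hdom] with x hx using hC x (hsub hx)

theorem exists_hasPieces {s : ℝ} (hs : 0 < s) (p : Cell N → ((Fin 3 → ℝ) →ᵃ[ℝ] ℝ)) :
    ∃ v : L2 s N, HasPieces s v p := by
  have hmem : MemLp (fun x => ∑ K : Cell N, (K.cube s).indicator (p K) x) 2
      (volume.restrict (domain s N)) :=
    memLp_finsetSum _ fun K _ => (memLp_affineMap s N (p K)).indicator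
      (K.isOpen_cube s).measurableSet
  refine ⟨hmem.toLp _, fun K => ?_⟩
  filter_upwards [hmem.coeFn_toLp] with x hx hK
  rw [hx, Finset.sum_eq_single K, Set.indicator_of_mem hK]
  · intro L _ hL
    exact Set.indicator_of_notMem (fun h => hL (Cell.eq_of_mem_cube hs h hK)) _
  · simp

end

end PeriodicP1NC

/-! ### The periodic space as the image of the compatible face values -/

namespace PeriodicP1NC

section

variable {N : Fin 3 → ℕ} [∀ ι, NeZero (N ι)]

/-- The cell whose lowest corner is a given lattice point, modulo the periods. -/
def wrap (N : Fin 3 → ℕ) [∀ ι, NeZero (N ι)] (a : Fin 3 → ℕ) : Cell N :=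
  fun κ => Fin.ofNat (N κ) (a κ)

theorem wrap_val (a : Fin 3 → ℕ) (κ : Fin 3) : ((wrap N a κ : Fin (N κ)) : ℕ) = a κ % N κ := rfl

theorem wrap_eq_iff (a : Fin 3 → ℕ) (z : Cell N) : wrap N a = z ↔ ∀ κ, a κ % N κ = (z κ : ℕ) := by
  rw [funext_iff]
  exact forall_congr' fun κ => Fin.ext_iff

theorem wrap_add_single (a : Fin 3 → ℕ) (ι : Fin 3) :
    wrap N (a + Pi.single ι 1) = wrap N a + step ι := by
  funext κ
  apply Fin.ext
  rw [wrap_val, Pi.add_apply, Pi.add_apply, Fin.val_add, wrap_val, step]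
  rcases eq_or_ne κ ι with rfl | h
  · rw [Pi.single_eq_same, Pi.single_eq_same, Fin.val_one', ← Nat.add_mod]
  · rw [Pi.single_eq_of_ne h, Pi.single_eq_of_ne h, Fin.val_zero, add_zero, add_zero, Nat.mod_mod]

theorem wrap_val_cell (K : Cell N) : wrap N (fun κ => (K κ : ℕ)) = K := by
  rw [wrap_eq_iff]
  exact fun κ => Nat.mod_eq_of_lt (K κ).2

theorem wrap_of_lower {f : Face N} {K : Cell N} (h : f.IsFaceOf K)
    (h0 : f.pos f.axis = (K f.axis : ℕ)) : wrap N f.pos = K := by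
  rw [← wrap_val_cell K]
  congr 1
  funext κ
  by_cases hκ : κ = f.axis
  exacts [hκ ▸ h0, h.1 κ hκ]

theorem wrap_of_upper {f : Face N} {K : Cell N} (h : f.IsFaceOf K)
    (h0 : f.pos f.axis = (K f.axis : ℕ) + 1) : wrap N f.pos = K + step f.axis := by
  conv_rhs => rw [← wrap_val_cell K]
  rw [← wrap_add_single]
  congr 1
  funext κ
  by_cases hκ : κ = f.axis
  · rw [hκ, h0]; simp
  · rw [h.1 κ hκ]; simp [hκ]

/-- The values that periodic face values assign to the faces of the mesh. -/
def faceFun (m : FaceValues N) (f : Face N) : ℝ := m f.axis (wrap N f.pos)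

/-- `v` has the face values `m` if its pieces attain them on both faces of each cell along each
axis. -/
theorem hasBarycenterValues_iff {s : ℝ} {v : L2 s N} {m : FaceValues N} :
    HasBarycenterValues s v (faceFun m) ↔ ∃ p, HasPieces s v p ∧ ∀ (K : Cell N) (μ : Fin 3),
      p K (K.center s + Pi.single μ (-(s / 2))) = m μ K ∧
        p K (K.center s + Pi.single μ (s / 2)) = m μ (K + step μ) := by
  refine exists_congr fun p => and_congr_right fun _ => ⟨fun h K μ => ⟨?_, ?_⟩, ?_⟩
  · have := h _ K (K.isFaceOf_lowerFace μ)
    rwa [Face.barycenter_eq_sub (K.isFaceOf_lowerFace μ) rfl, faceFun,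
      wrap_of_lower (K.isFaceOf_lowerFace μ) rfl] at this
  · have h1 : (K.upperFace μ).pos (K.upperFace μ).axis = (K (K.upperFace μ).axis : ℕ) + 1 := by
      simp [Cell.upperFace]
    have := h _ K (K.isFaceOf_upperFace μ)
    rwa [Face.barycenter_eq_add (K.isFaceOf_upperFace μ) h1, faceFun,
      wrap_of_upper (K.isFaceOf_upperFace μ) h1] at this
  · intro h f K hf
    rcases hf.2 with h0 | h1
    · rw [Face.barycenter_eq_sub hf h0, faceFun, wrap_of_lower hf h0, (h K _).1]
    · rw [Face.barycenter_eq_add hf h1, faceFun, wrap_of_upper hf h1, (h K _).2]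

/-- The linear polynomial on the cell `K` with prescribed values at the face barycenters. -/
noncomputable def cellPiece (s : ℝ) (m : FaceValues N) (K : Cell N) : (Fin 3 → ℝ) →ᵃ[ℝ] ℝ :=
  (∑ κ, ((m κ (K + step κ) - m κ K) / s) • LinearMap.proj κ : (Fin 3 → ℝ) →ₗ[ℝ] ℝ).toAffineMap +
    -- The value at the center is taken from axis 0. For compatible values every axis gives the same
    -- number; for others the formula is still linear in `m`.
    AffineMap.const ℝ (Fin 3 → ℝ) (pairSum 0 (m 0) K / 2 -
      ∑ κ, (m κ (K + step κ) - m κ K) / s * K.center s κ)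

theorem cellPiece_apply (s : ℝ) (m : FaceValues N) (K : Cell N) (x : Fin 3 → ℝ) :
    cellPiece s m K x = pairSum 0 (m 0) K / 2 +
      ∑ κ, (m κ (K + step κ) - m κ K) / s * (x κ - K.center s κ) := by
  simp only [cellPiece, AffineMap.coe_add, LinearMap.coe_toAffineMap, Pi.add_apply,
    LinearMap.coe_sum, Finset.sum_apply, LinearMap.smul_apply, LinearMap.proj_apply, smul_eq_mul,
    AffineMap.const_apply, mul_sub, Finset.sum_sub_distrib]
  ring

theorem cellPiece_add (s : ℝ) (m n : FaceValues N) :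
    cellPiece s (m + n) = cellPiece s m + cellPiece s n := by
  funext K
  refine AffineMap.ext fun x => ?_
  simp only [Pi.add_apply, AffineMap.coe_add, cellPiece_apply, map_add]
  simp only [Fin.sum_univ_three]
  ring

theorem cellPiece_smul (s : ℝ) (c : ℝ) (m : FaceValues N) :
    cellPiece s (c • m) = c • cellPiece s m := by
  funext K
  refine AffineMap.ext fun x => ?_
  simp only [Pi.smul_apply, AffineMap.coe_smul, cellPiece_apply, map_smul, smul_eq_mul]
  simp only [Fin.sum_univ_three]
  ring

theorem cellPiece_apply_center_add_single (s : ℝ) (m : FaceValues N) (K : Cell N) (μ : Fin 3)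
    (a : ℝ) : cellPiece s m K (K.center s + Pi.single μ a) =
      pairSum 0 (m 0) K / 2 + (m μ (K + step μ) - m μ K) / s * a := by
  rw [cellPiece_apply, Finset.sum_eq_single μ]
  · simp
  · intro κ _ hκ
    simp [hκ]
  · simp

theorem eq_cellPiece {s : ℝ} (hs : s ≠ 0) {m : FaceValues N} {K : Cell N}
    {q : (Fin 3 → ℝ) →ᵃ[ℝ] ℝ}
    (hq : ∀ μ, q (K.center s + Pi.single μ (-(s / 2))) = m μ K ∧
      q (K.center s + Pi.single μ (s / 2)) = m μ (K + step μ)) : q = cellPiece s m K := by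
  have hlin (μ : Fin 3) : q.linear (Pi.single μ 1) = (m μ (K + step μ) - m μ K) / s := by
    obtain ⟨h1, h2⟩ := hq μ
    rw [affineMap_apply_add_single] at h1 h2
    rw [← h1, ← h2]
    field_simp
    ring
  have hc : q (K.center s) = pairSum 0 (m 0) K / 2 := by
    obtain ⟨h1, h2⟩ := hq 0
    rw [affineMap_apply_add_single] at h1 h2
    rw [pairSum_apply, ← h1, ← h2]
    ring
  refine AffineMap.ext fun x => ?_
  have hx : x = K.center s + (x - K.center s) := by abel
  conv_lhs => rw [hx]
  rw [affineMap_apply_add, cellPiece_apply, hc]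
  simp only [hlin, Pi.sub_apply, mul_comm]

/-- The piecewise linear function with given face values. -/
noncomputable def ofValues {s : ℝ} (hs : 0 < s) (N : Fin 3 → ℕ) [∀ ι, NeZero (N ι)] :
    FaceValues N →ₗ[ℝ] L2 s N where
  toFun m := (exists_hasPieces hs (cellPiece s m)).choose
  map_add' m n := by
    refine (exists_hasPieces hs (cellPiece s (m + n))).choose_spec.eq hs ?_
    rw [cellPiece_add]
    exact (exists_hasPieces hs _).choose_spec.add (exists_hasPieces hs _).choose_spec
  map_smul' c m := by
    refine (exists_hasPieces hs (cellPiece s (c • m))).choose_spec.eq hs ?_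
    rw [cellPiece_smul]
    exact (exists_hasPieces hs _).choose_spec.smul c

theorem hasPieces_ofValues {s : ℝ} (hs : 0 < s) (m : FaceValues N) :
    HasPieces s (ofValues hs N m) (cellPiece s m) :=
  (exists_hasPieces hs (cellPiece s m)).choose_spec

theorem HasBarycenterValues.eq_ofValues {s : ℝ} (hs : 0 < s) {v : L2 s N} {m : FaceValues N}
    (h : HasBarycenterValues s v (faceFun m)) : v = ofValues hs N m := by
  obtain ⟨p, hp, hv⟩ := hasBarycenterValues_iff.mp h
  have : p = cellPiece s m := funext fun K => eq_cellPiece hs.ne' (hv K)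
  exact (this ▸ hp).eq hs (hasPieces_ofValues hs m)

/-- Along each axis, the two barycenter values average to the value of the affine piece at the cell
center. -/
theorem HasBarycenterValues.mem_compatible {s : ℝ} {v : L2 s N} {m : FaceValues N}
    (h : HasBarycenterValues s v (faceFun m)) : m ∈ compatible N := by
  obtain ⟨p, hp, hv⟩ := hasBarycenterValues_iff.mp h
  have key (K : Cell N) (μ : Fin 3) : pairSum μ (m μ) K = 2 * p K (K.center s) := by
    rw [pairSum_apply, ← (hv K μ).1, ← (hv K μ).2, affineMap_apply_add_single,
      affineMap_apply_add_single]
    ring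
  intro μ ν
  funext K
  rw [key, key]

theorem hasBarycenterValues_ofValues {s : ℝ} (hs : 0 < s) {m : FaceValues N}
    (hm : m ∈ compatible N) : HasBarycenterValues s (ofValues hs N m) (faceFun m) := by
  refine hasBarycenterValues_iff.mpr ⟨_, hasPieces_ofValues hs m, fun K μ => ?_⟩
  have hs' := hs.ne'
  rw [cellPiece_apply_center_add_single, cellPiece_apply_center_add_single, hm 0 μ, pairSum_apply]
  constructor <;> field_simp <;> ring

theorem HasBarycenterValues.mem_perSpace {s : ℝ} (hs : 0 < s) {v : L2 s N} {m : FaceValues N}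
    (h : HasBarycenterValues s v (faceFun m)) : v ∈ perSpace s N := by
  obtain ⟨p, hp, hv⟩ := h
  refine ⟨⟨p, hp, fun f K L _ hK hL => ?_⟩, p, hp, fun f g K L hfg hK hL => ?_⟩
  · rw [f.average_eq_barycenter hs.ne', f.average_eq_barycenter hs.ne', hv f K hK, hv f L hL]
  · rw [f.average_eq_barycenter hs.ne', g.average_eq_barycenter hs.ne', hv f K hK, hv g L hL]
    obtain ⟨haxis, h0, h1, hpos⟩ := hfg
    have : wrap N f.pos = wrap N g.pos := by
      rw [wrap_eq_iff]
      intro κ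
      rw [wrap_val]
      by_cases hκ : κ = f.axis
      · rw [hκ, h0, haxis, h1, Nat.mod_self, Nat.zero_mod]
      · rw [hpos κ hκ]
    rw [faceFun, faceFun, this, haxis]

theorem exists_hasBarycenterValues_of_mem_perSpace {s : ℝ} (hs : 0 < s) {v : L2 s N}
    (hv : v ∈ perSpace s N) : ∃ m, HasBarycenterValues s v (faceFun m) := by
  obtain ⟨⟨p, hp, hint⟩, p', hp', hopp⟩ := hv
  obtain rfl := hp.unique hs hp'
  -- Values are read off on lower faces. What remains is that the upper face of `K` carries the
  -- lower value of the next cell: by the jump condition inside Ω, by the condition on opposite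
  -- faces where the step wraps around.
  refine ⟨fun μ K => p K (K.center s + Pi.single μ (-(s / 2))),
    hasBarycenterValues_iff.mpr ⟨p, hp, fun K μ => ⟨rfl, ?_⟩⟩⟩
  have hup := K.isFaceOf_upperFace μ
  have hup1 : (K.upperFace μ).pos (K.upperFace μ).axis = (K (K.upperFace μ).axis : ℕ) + 1 := by
    simp [Cell.upperFace]
  have hstep (κ : Fin 3) (hκ : κ ≠ μ) : (K + step μ : Cell N) κ = K κ := by simp [step, hκ]
  have hstep' : (((K + step μ : Cell N) μ : Fin (N μ)) : ℕ) = ((K μ : ℕ) + 1) % N μ := by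
    rw [Pi.add_apply, step, Pi.single_eq_same, Fin.val_add, Fin.val_one', Nat.add_mod_mod]
  have hlow := (K + step μ : Cell N).isFaceOf_lowerFace μ
  have e1 : (K.upperFace μ).average s (p K) = p K (K.center s + Pi.single μ (s / 2)) := by
    rw [Face.average_eq_barycenter hs.ne', Face.barycenter_eq_add hup hup1]
    rfl
  have e2 : ((K + step μ : Cell N).lowerFace μ).average s (p (K + step μ)) =
      p (K + step μ) ((K + step μ : Cell N).center s + Pi.single μ (-(s / 2))) := by
    rw [Face.average_eq_barycenter hs.ne', Face.barycenter_eq_sub hlow rfl]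
    rfl
  rw [← e1, ← e2]
  rcases Nat.lt_or_ge ((K μ : ℕ) + 1) (N μ) with hlt | hge
  · rw [Nat.mod_eq_of_lt hlt] at hstep'
    have hface : K.upperFace μ = (K + step μ : Cell N).lowerFace μ := by
      simp only [Cell.upperFace, Cell.lowerFace, Face.mk.injEq, true_and]
      funext κ
      rcases eq_or_ne κ μ with rfl | hκ
      · rw [hstep', if_pos rfl]
      · rw [hstep κ hκ, if_neg hκ, add_zero]
    rw [← hface] at hlow ⊢
    refine hint _ _ _ ⟨?_, ?_⟩ hup hlow
    · rw [hup1]; exact Nat.succ_pos _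
    · rw [hup1]; exact hlt
  · have hN : (K μ : ℕ) + 1 = N μ := le_antisymm (K μ).2 hge
    rw [hN, Nat.mod_self] at hstep'
    have hopposite : ((K + step μ : Cell N).lowerFace μ).IsOpposite (K.upperFace μ) := by
      refine ⟨rfl, ?_, hup1.trans hN, fun κ hκ => ?_⟩
      · change (((K + step μ : Cell N) μ : Fin (N μ)) : ℕ) = 0
        exact hstep'
      · change κ ≠ μ at hκ
        change (((K + step μ : Cell N) κ : Fin (N κ)) : ℕ) = (K κ : ℕ) + if κ = μ then 1 else 0
        rw [hstep κ hκ, if_neg hκ, add_zero]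
    exact (hopp _ _ _ _ hopposite hlow hup).symm

theorem perSpace_eq_map {s : ℝ} (hs : 0 < s) :
    perSpace s N = (compatible N).map (ofValues hs N) := by
  ext v
  constructor
  · intro hv
    obtain ⟨m, hm⟩ := exists_hasBarycenterValues_of_mem_perSpace hs hv
    exact ⟨m, hm.mem_compatible, (hm.eq_ofValues hs).symm⟩
  · rintro ⟨m, hm, rfl⟩
    exact (hasBarycenterValues_ofValues hs hm).mem_perSpace hs

theorem injOn_ofValues {s : ℝ} (hs : 0 < s) :
    Set.InjOn (ofValues hs N) (compatible N : Set (FaceValues N)) := by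
  intro m hm n hn h
  obtain ⟨p, hp, hpm⟩ := hasBarycenterValues_iff.mp (hasBarycenterValues_ofValues hs hm)
  obtain ⟨q, hq, hqn⟩ := hasBarycenterValues_iff.mp (hasBarycenterValues_ofValues hs hn)
  rw [← h] at hq
  obtain rfl := hp.unique hs hq
  funext μ K
  rw [← (hpm K μ).1, (hqn K μ).1]

end

end PeriodicP1NC

/-! ### Node-based and alternating functions, and the complementary bases -/

namespace PeriodicP1NC

/-- Injectivity on `V` suffices because `U` and the span lie in `V`. It is all that `ofValues`
offers: on incompatible values it loses information. -/
theorem IsComplementaryBasis.map {E F : Type*} [AddCommGroup E] [Module ℝ E] [AddCommGroup F]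
    [Module ℝ F] {U V : Submodule ℝ E} {I : Type*} {b : I → E} (h : IsComplementaryBasis U V b)
    (T : E →ₗ[ℝ] F) (hT : Set.InjOn T (V : Set E)) :
    IsComplementaryBasis (U.map T) (V.map T) fun i => T (b i) := by
  obtain ⟨hb, hli, hdisj, hsup⟩ := h
  have hU : U ≤ V := hsup ▸ le_sup_left
  have hS : Submodule.span ℝ (Set.range b) ≤ V := hsup ▸ le_sup_right
  have hrange : Submodule.span ℝ (Set.range fun i => T (b i)) =
      (Submodule.span ℝ (Set.range b)).map T := by
    rw [Submodule.map_span, ← Set.range_comp]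
    rfl
  refine ⟨fun i => ⟨⟨b i, (hb i).1, rfl⟩, ?_⟩, hli.map_injOn T (hT.mono hS), ?_, ?_⟩
  · rintro ⟨u, hu, hui⟩
    exact (hb i).2 (hT (hU hu) (hb i).1 hui ▸ hu)
  · rw [hrange, Submodule.disjoint_def]
    rintro _ ⟨u, hu, rfl⟩ ⟨w, hw, hwu⟩
    have := hT (hS hw) (hU hu) hwu
    rw [Submodule.disjoint_def.mp hdisj u hu (this ▸ hw), map_zero]
  · rw [hrange, ← Submodule.map_sup, hsup]

section

variable {N : Fin 3 → ℕ} [∀ ι, NeZero (N ι)]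

theorem exists_add_single_iff (ν : Fin 3) (pos : Fin 3 → ℕ) (P : (Fin 3 → ℕ) → Prop) :
    (∃ a : Fin 3 → ℕ, P a ∧ a ν = pos ν ∧ ∀ κ, κ ≠ ν → a κ = pos κ ∨ a κ = pos κ + 1) ↔
      P pos ∨ P (pos + Pi.single (ν + 1) 1) ∨ P (pos + Pi.single (ν + 2) 1) ∨
        P (pos + Pi.single (ν + 1) 1 + Pi.single (ν + 2) 1) := by
  have hcov : ∀ κ, κ = ν ∨ κ = ν + 1 ∨ κ = ν + 2 := by revert ν; decide
  have h10 : ν + 1 ≠ ν := (ne_add_one ν).symm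
  have h20 : ν + 2 ≠ ν := (ne_add_two ν).symm
  have h12 : ν + 1 ≠ ν + 2 := add_one_ne_add_two ν
  constructor
  · rintro ⟨a, ha, h0, h⟩
    have ext (b : Fin 3 → ℕ) (e0 : a ν = b ν) (e1 : a (ν + 1) = b (ν + 1))
        (e2 : a (ν + 2) = b (ν + 2)) : P b := by
      have : a = b := by
        funext κ
        rcases hcov κ with rfl | rfl | rfl
        exacts [e0, e1, e2]
      exact this ▸ ha
    rcases h _ h10 with h1 | h1 <;> rcases h _ h20 with h2 | h2
    · exact Or.inl (ext _ h0 h1 h2)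
    · exact Or.inr (Or.inr (Or.inl (ext _ (by simp [h0]) (by simp [h1]) (by simp [h2]))))
    · exact Or.inr (Or.inl (ext _ (by simp [h0]) (by simp [h1]) (by simp [h2])))
    · exact Or.inr (Or.inr (Or.inr (ext _ (by simp [h0]) (by simp [h1]) (by simp [h2]))))
  · rintro (h | h | h | h)
    · exact ⟨_, h, rfl, fun _ _ => Or.inl rfl⟩
    all_goals
      refine ⟨_, h, by simp, fun κ hκ => ?_⟩
      rcases hcov κ with rfl | rfl | rfl
      · exact absurd rfl hκ
      · simp
      · simp

theorem containsNode_iff (f : Face N) (z : Cell N) :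
    f.ContainsNode z ↔ wrap N f.pos = z ∨ wrap N f.pos + step (f.axis + 1) = z ∨
      wrap N f.pos + step (f.axis + 2) = z ∨
        wrap N f.pos + step (f.axis + 1) + step (f.axis + 2) = z := by
  simp only [Face.ContainsNode, ← wrap_eq_iff]
  rw [exists_add_single_iff f.axis f.pos fun a => wrap N a = z]
  simp only [wrap_add_single]

theorem step_apply_self_ne_zero (hN : ∀ ι, 2 ≤ N ι) (ι : Fin 3) : (step ι : Cell N) ι ≠ 0 := by
  rw [step, Pi.single_eq_same, Ne, Fin.ext_iff, Fin.val_one', Fin.val_zero,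
    Nat.mod_eq_of_lt (hN ι)]
  exact one_ne_zero

/-- With every period at least 2, the four vertices of a face remain distinct after identification,
so at most one of the four terms of the double pair sum is nonzero. -/
theorem faceFun_nodeValues_single (hN : ∀ ι, 2 ≤ N ι) (z : Cell N) :
    faceFun (nodeValues N (Pi.single z 1)) =
      {f : Face N | f.ContainsNode z}.indicator fun _ => (1 / 2 : ℝ) := by
  classical
  funext f
  have h12 : f.axis + 1 ≠ f.axis + 2 := add_one_ne_add_two _
  have e1 := step_apply_self_ne_zero hN (f.axis + 1)
  have e2 := step_apply_self_ne_zero hN (f.axis + 2)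
  have e12 : (step (f.axis + 2) : Cell N) (f.axis + 1) = 0 := by
    rw [step, Pi.single_eq_of_ne h12]
  have hval : faceFun (nodeValues N (Pi.single z 1)) f = 1 / 2 *
      ((if wrap N f.pos = z then 1 else 0) + (if wrap N f.pos + step (f.axis + 2) = z then 1 else 0)
        + ((if wrap N f.pos + step (f.axis + 1) = z then 1 else 0) +
          if wrap N f.pos + step (f.axis + 1) + step (f.axis + 2) = z then 1 else 0)) := by
    simp only [faceFun, nodeValues_apply, Pi.smul_apply, pairSum_apply, Pi.single_apply,
      smul_eq_mul]
  have hind : ({f : Face N | f.ContainsNode z}.indicator fun _ => (1 / 2 : ℝ)) f =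
      if f.ContainsNode z then 1 / 2 else 0 := by
    rw [Set.indicator_apply]
    rfl
  rw [hval, hind]
  simp only [containsNode_iff]
  generalize (step (f.axis + 1) : Cell N) = a at *
  generalize (step (f.axis + 2) : Cell N) = b at *
  generalize wrap N f.pos = K at *
  have ha : a ≠ 0 := fun h => e1 (by rw [h]; rfl)
  have hb : b ≠ 0 := fun h => e2 (by rw [h]; rfl)
  have hab : a + b ≠ 0 := fun h => e1 (by simpa [e12] using congrFun h (f.axis + 1))
  have hne : b ≠ a := fun h => e1 (by rw [← h, e12])
  by_cases h0 : K = z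
  · subst h0
    simp [ha, hb, hab, add_assoc]
  by_cases h1 : K + a = z
  · subst h1
    simp [ha, hb, hne]
  by_cases h2 : K + b = z
  · subst h2
    simp [ha, hb, hne.symm, add_right_comm K a b]
  by_cases h3 : K + a + b = z <;> simp [h0, h1, h2, h3]

theorem isNodeBased_iff {s : ℝ} (hs : 0 < s) (hN : ∀ ι, 2 ≤ N ι) (z : Cell N) (φ : L2 s N) :
    IsNodeBased s z φ ↔ φ = ofValues hs N (nodeValues N (Pi.single z 1)) := by
  rw [IsNodeBased, ← faceFun_nodeValues_single hN]
  constructor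
  · exact fun h => h.2.eq_ofValues hs
  · rintro rfl
    have := hasBarycenterValues_ofValues hs (nodeValues_mem (Pi.single z 1))
    exact ⟨this.mem_perSpace hs, this⟩

theorem nodeSpace_eq_map {s : ℝ} (hs : 0 < s) (hN : ∀ ι, 2 ≤ N ι) :
    nodeSpace s N = (LinearMap.range (nodeValues N)).map (ofValues hs N) := by
  have hspan : Submodule.span ℝ {φ : L2 s N | ∃ z : Cell N, IsNodeBased s z φ} =
      (LinearMap.range (nodeValues N)).map (ofValues hs N) := by
    have htop : Submodule.span ℝ (Set.range fun z : Cell N => (Pi.single z 1 : Cell N → ℝ)) = ⊤ := by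
      rw [← (Pi.basisFun ℝ (Cell N)).span_eq]
      congr 2
      funext z
      simp
    rw [LinearMap.range_eq_map, ← htop, Submodule.map_span, Submodule.map_span, ← Set.range_comp,
      ← Set.range_comp]
    congr 1
    ext φ
    simp only [Set.mem_ofPred_eq, isNodeBased_iff hs hN, Set.mem_range, Function.comp_apply, eq_comm]
  rw [nodeSpace, hspan, perSpace_eq_map hs, inf_eq_right]
  refine Submodule.map_mono ?_
  rintro _ ⟨u, rfl⟩
  exact nodeValues_mem u

/-- Wrapping preserves the parity of coordinates along the even periods. It does not move the slab
coordinate, since a face perpendicular to another axis lies strictly below the upper end of the slab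
axis. -/
theorem faceFun_smul_altValues {i : AltIndex N} (hi : i.Admissible) (ε : ℝ) (f : Face N) :
    faceFun (ε • altValues i) f = if f.axis = i.2.2 ∧ f.pos i.1 = (i.2.1 : ℕ) then
      ε * (-1) ^ (∑ κ ∈ Finset.univ.erase i.1, f.pos κ) else 0 := by
  have hsign : altSign i.1 (wrap N f.pos) = (-1) ^ (∑ κ ∈ Finset.univ.erase i.1, f.pos κ) := by
    rw [altSign, ← Finset.prod_pow_eq_pow_sum, ← Finset.prod_pow_eq_pow_sum]
    refine Finset.prod_congr rfl fun κ hκ => ?_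
    rw [wrap_val, neg_one_pow_mod_of_even (hi κ (Finset.ne_of_mem_erase hκ))]
  have hiff : (f.axis = i.2.2 ∧ wrap N f.pos i.1 = i.2.1) ↔
      (f.axis = i.2.2 ∧ f.pos i.1 = (i.2.1 : ℕ)) := by
    refine and_congr_right fun h => ?_
    rw [Fin.ext_iff, wrap_val, Nat.mod_eq_of_lt (f.lt_of_ne _ ?_)]
    rw [h]
    exact i.2.2.2.symm
  simp only [faceFun, Pi.smul_apply, altValues, smul_eq_mul, hiff, hsign, mul_ite, mul_zero]

theorem isAlternating_iff {s : ℝ} (hs : 0 < s) {i : AltIndex N} (hi : i.Admissible) (ψ : L2 s N) :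
    IsAlternating s i ψ ↔
      ∃ ε : ℝ, (ε = 1 ∨ ε = -1) ∧ ψ = ofValues hs N (ε • altValues i) := by
  simp only [IsAlternating, ← faceFun_smul_altValues hi]
  constructor
  · rintro ⟨-, ε, hε, h⟩
    exact ⟨ε, hε, h.eq_ofValues hs⟩
  · rintro ⟨ε, hε, rfl⟩
    have := hasBarycenterValues_ofValues hs (Submodule.smul_mem _ ε (altValues_mem hi))
    exact ⟨this.mem_perSpace hs, ε, hε, this⟩

theorem exists_isAlternating {s : ℝ} (hs : 0 < s) {i : AltIndex N} (hi : i.Admissible) :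
    ∃ ψ : L2 s N, IsAlternating s i ψ :=
  ⟨_, (isAlternating_iff hs hi _).mpr ⟨1, Or.inl rfl, rfl⟩⟩

/-- Admissible alternating functions that span all the admissible ones and omit one index for each
subscript form a complementary basis. -/
theorem isComplementaryBasis_of_isAlternating {s : ℝ} (hs : 0 < s) (hN : ∀ ι, 2 ≤ N ι) {I : Type*}
    {e : I → AltIndex N} (he : Function.Injective e) (hadm : ∀ i, (e i).Admissible)
    (hmiss : ∀ μ : Fin 3, ∃ i : AltIndex N, (i.2.2 : Fin 3) = μ ∧ i ∉ Set.range e)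
    (hspan : ∀ i : AltIndex N, i.Admissible →
      altValues i ∈ Submodule.span ℝ (Set.range fun k => altValues (e k)))
    {ψ : I → L2 s N} (hψ : ∀ i, IsAlternating s (e i) (ψ i)) :
    IsComplementaryBasis (nodeSpace s N) (perSpace s N) ψ := by
  choose ε hε hψε using fun i => (isAlternating_iff hs (hadm i) _).mp (hψ i)
  obtain rfl : ψ = fun i => ofValues hs N (ε i • altValues (e i)) := funext hψε
  rw [nodeSpace_eq_map hs hN, perSpace_eq_map hs]
  exact (isComplementaryBasis_altValues he hadm hmiss hspan hε).map _ (injOn_ofValues hs)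

/-- The number of alternating functions with a given subscript. -/
theorem card_altFamily (N : Fin 3 → ℕ) (μ : Fin 3) :
    (altFamily N μ).card = N (μ + 1) + N (μ + 2) := by
  have hinner : ∀ ι : Fin 3, (∑ ν : {ν : Fin 3 // ν ≠ ι}, if (ν : Fin 3) = μ then 1 else 0) =
      if μ ≠ ι then 1 else 0 := by
    revert μ; decide
  rw [altFamily, Finset.card_filter, Fintype.sum_sigma]
  simp only [Fintype.sum_prod_type, hinner]
  fin_cases μ <;> simp [Fin.sum_univ_three, add_comm]

theorem nodeSpace_lt_perSpace {s : ℝ} (hs : 0 < s) (hN : ∀ ι, 2 ≤ N ι) {i : AltIndex N}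
    (hi : i.Admissible) : nodeSpace s N < perSpace s N := by
  rw [nodeSpace_eq_map hs hN, perSpace_eq_map hs]
  refine lt_of_le_of_ne (Submodule.map_mono ?_) fun h => ?_
  · rintro _ ⟨u, rfl⟩
    exact nodeValues_mem u
  · obtain ⟨_, ⟨u, rfl⟩, hu⟩ := h.symm ▸ Submodule.mem_map_of_mem (f := ofValues hs N)
      (altValues_mem hi)
    have hu' := injOn_ofValues hs (nodeValues_mem u) (altValues_mem hi) hu
    have h0 := Submodule.disjoint_def.mp disjoint_range_nodeValues_span_altValues _
      ⟨u, hu'⟩ (Submodule.subset_span ⟨i, hi, rfl⟩)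
    have h1 := congrFun (congrFun h0 i.2.2) (Pi.single i.1 i.2.1)
    have h2 := altSign_mul_self i.1 (Pi.single i.1 i.2.1 : Cell N)
    simp only [altValues, Pi.single_eq_same, and_self, if_true, Pi.zero_apply] at h1
    rw [h1, zero_mul] at h2
    exact zero_ne_one h2

theorem isComplementaryBasis_of_card {s : ℝ} (hs : 0 < s) (hN : ∀ ι, 2 ≤ N ι)
    (heven : ∀ ι, Even (N ι)) {T : Fin 3 → Finset (AltIndex N)} (hT : ∀ μ, T μ ⊆ altFamily N μ)
    (hcard : ∀ μ, (T μ).card + 1 = N (μ + 1) + N (μ + 2)) {J : Finset (AltIndex N)}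
    (hJ : ∀ i, i ∈ J ↔ i ∈ T i.2.2) {ψ : AltIndex N → L2 s N}
    (hψ : ∀ i, IsAlternating s i (ψ i)) :
    IsComplementaryBasis (nodeSpace s N) (perSpace s N) fun i : J => ψ i := by
  have homit (μ : Fin 3) : ∃ i, altFamily N μ \ T μ = {i} := by
    -- The cardinality leaves exactly one index out per subscript; the linear relation recovers that
    -- function from the others.
    rw [← Finset.card_eq_one, Finset.card_sdiff_of_subset (hT μ), card_altFamily, ← hcard,
      Nat.add_sub_cancel_left]
  have hmem (i : AltIndex N) : i ∈ altFamily N i.2.2 := by simp [altFamily]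
  refine isComplementaryBasis_of_isAlternating hs hN (e := fun i : J => (i : AltIndex N))
    Subtype.val_injective (fun i κ _ => heven κ) (fun μ => ?_) (fun i _ => ?_) fun i => hψ i
  · obtain ⟨i, hi⟩ := homit μ
    have h : i ∈ altFamily N μ \ T μ := hi ▸ Finset.mem_singleton_self i
    rw [Finset.mem_sdiff] at h
    have hμ : (i.2.2 : Fin 3) = μ := (Finset.mem_filter.mp h.1).2
    refine ⟨i, hμ, ?_⟩
    rw [Subtype.range_coe_subtype]
    exact fun hi => h.2 (hμ ▸ (hJ i).mp hi)
  · by_cases hi : i ∈ J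
    · exact Submodule.subset_span ⟨⟨i, hi⟩, rfl⟩
    · refine altValues_mem_span_of_omits_one fun k hk hki => ?_
      by_contra hkJ
      have hkJ' : k ∉ J := fun h => hkJ ⟨⟨k, h⟩, rfl⟩
      obtain ⟨l, hl⟩ := homit i.2.2
      have h1 : i ∈ altFamily N i.2.2 \ T i.2.2 :=
        Finset.mem_sdiff.mpr ⟨hmem i, fun h => hi ((hJ i).mpr h)⟩
      have h2 : k ∈ altFamily N i.2.2 \ T i.2.2 :=
        Finset.mem_sdiff.mpr ⟨hk ▸ hmem k, fun h => hkJ' ((hJ k).mpr (hk.symm ▸ h))⟩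
      rw [hl, Finset.mem_singleton] at h1 h2
      exact hki (h2.trans h1.symm)

/-- Admissible indices are those with slab axis ι. The formal values for another slab axis supply
the omitted index for each subscript, although no function belongs to them. -/
theorem isComplementaryBasis_of_odd {s : ℝ} (hs : 0 < s) (hN : ∀ ι, 2 ≤ N ι) {ι : Fin 3}
    (hodd : Odd (N ι)) (heven : ∀ κ, κ ≠ ι → Even (N κ))
    {ψ : Fin (N ι) × {μ : Fin 3 // μ ≠ ι} → L2 s N} (hψ : ∀ i, IsAlternating s ⟨ι, i⟩ (ψ i)) :
    IsComplementaryBasis (nodeSpace s N) (perSpace s N) ψ := by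
  refine isComplementaryBasis_of_isAlternating hs hN
    (e := fun i => (⟨ι, i⟩ : AltIndex N))
    (fun i j h => eq_of_heq (Sigma.mk.inj h).2) (fun _ => heven) (fun μ => ?_)
    (fun i hi => ?_) hψ
  · obtain ⟨κ, hμκ, hκ⟩ : ∃ κ, μ ≠ κ ∧ κ ≠ ι := exists_third_axis μ ι
    refine ⟨⟨κ, 0, μ, hμκ⟩, rfl, ?_⟩
    rintro ⟨i, hi⟩
    exact hκ (congrArg Sigma.fst hi).symm
  · obtain ⟨κ, i⟩ := i
    obtain rfl : κ = ι := by
      by_contra h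
      exact Nat.not_even_iff_odd.mpr hodd (hi ι (Ne.symm h))
    exact Submodule.subset_span ⟨i, rfl⟩

/-- Without admissible indices the empty family is a complementary basis. -/
theorem nodeSpace_eq_perSpace {s : ℝ} (hs : 0 < s) (hN : ∀ ι, 2 ≤ N ι)
    (h : ∀ i : AltIndex N, ¬ i.Admissible) : nodeSpace s N = perSpace s N := by
  have := (isComplementaryBasis_of_isAlternating hs hN (e := Empty.elim) (ψ := Empty.elim)
    (fun i => i.elim) (fun i => i.elim)
    (fun μ => ⟨⟨μ + 1, 0, μ, ne_add_one μ⟩, rfl, by simp⟩) (fun i hi => (h i hi).elim)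
    (fun i => i.elim)).2.2.2
  rwa [Set.range_eq_empty, Submodule.span_empty, sup_bot_eq] at this

end

end PeriodicP1NC

/-! ### The three parity cases -/

theorem theorem6p11 (s : ℝ) (hs : 0 < s) (N : Fin 3 → ℕ) (hN : ∀ ι, 2 ≤ N ι) :
    ((∀ ι, Even (N ι)) →
      PeriodicP1NC.nodeSpace s N < PeriodicP1NC.perSpace s N ∧
      (∀ i : PeriodicP1NC.AltIndex N, ∃ ψ, PeriodicP1NC.IsAlternating s i ψ) ∧
      ∀ ψ : PeriodicP1NC.AltIndex N → PeriodicP1NC.L2 s N,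
        (∀ i, PeriodicP1NC.IsAlternating s i (ψ i)) →
        ∀ Tx Ty Tz : Finset (PeriodicP1NC.AltIndex N),
          Tz ⊆ PeriodicP1NC.altFamily N 2 → Tz.card = N 0 + N 1 - 1 →
          Tx ⊆ PeriodicP1NC.altFamily N 0 → Tx.card = N 1 + N 2 - 1 →
          Ty ⊆ PeriodicP1NC.altFamily N 1 → Ty.card = N 2 + N 0 - 1 →
          (Tz ∪ Tx ∪ Ty).card = 2 * (N 0 + N 1 + N 2) - 3 ∧
          PeriodicP1NC.IsComplementaryBasis (PeriodicP1NC.nodeSpace s N)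
            (PeriodicP1NC.perSpace s N) (fun i : ↥(Tz ∪ Tx ∪ Ty) => ψ i)) ∧
    (∀ ι, Odd (N ι) → (∀ κ, κ ≠ ι → Even (N κ)) →
      PeriodicP1NC.nodeSpace s N < PeriodicP1NC.perSpace s N ∧
      (∀ i : Fin (N ι) × {μ : Fin 3 // μ ≠ ι}, ∃ ψ, PeriodicP1NC.IsAlternating s ⟨ι, i⟩ ψ) ∧
      ∀ ψ : Fin (N ι) × {μ : Fin 3 // μ ≠ ι} → PeriodicP1NC.L2 s N,
        (∀ i, PeriodicP1NC.IsAlternating s ⟨ι, i⟩ (ψ i)) →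
          Fintype.card (Fin (N ι) × {μ : Fin 3 // μ ≠ ι}) = 2 * N ι ∧
          PeriodicP1NC.IsComplementaryBasis (PeriodicP1NC.nodeSpace s N)
            (PeriodicP1NC.perSpace s N) ψ) ∧
    (¬ (∀ ι, Even (N ι)) → ¬ (∃ ι, Odd (N ι) ∧ ∀ κ, κ ≠ ι → Even (N κ)) →
      PeriodicP1NC.nodeSpace s N = PeriodicP1NC.perSpace s N) := by
  have : ∀ ι, NeZero (N ι) := fun ι => ⟨by have := hN ι; omega⟩
  have hN0 := hN 0
  have hN1 := hN 1
  have hN2 := hN 2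
  refine ⟨fun heven => ⟨?_, fun i => ?_, ?_⟩, fun ι hodd heven => ⟨?_, fun i => ?_, ?_⟩, ?_⟩
  · exact PeriodicP1NC.nodeSpace_lt_perSpace hs hN (i := ⟨0, 0, 1, by decide⟩) fun κ _ => heven κ
  · exact PeriodicP1NC.exists_isAlternating hs fun κ _ => heven κ
  · intro ψ hψ Tx Ty Tz hTz hz hTx hx hTy hy
    have hsub {T : Finset (PeriodicP1NC.AltIndex N)} {μ : Fin 3}
        (hT : T ⊆ PeriodicP1NC.altFamily N μ) {i} (hi : i ∈ T) : (i.2.2 : Fin 3) = μ :=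
      (Finset.mem_filter.mp (hT hi)).2
    constructor
    · have hzx : Disjoint Tz Tx := Finset.disjoint_left.mpr fun i h1 h2 =>
        absurd ((hsub hTz h1).symm.trans (hsub hTx h2)) (by decide)
      have hzxy : Disjoint (Tz ∪ Tx) Ty := Finset.disjoint_left.mpr fun i h1 h2 => by
        rcases Finset.mem_union.mp h1 with h1 | h1
        · exact absurd ((hsub hTz h1).symm.trans (hsub hTy h2)) (by decide)
        · exact absurd ((hsub hTx h1).symm.trans (hsub hTy h2)) (by decide)
      rw [Finset.card_union_of_disjoint hzxy, Finset.card_union_of_disjoint hzx, hz, hx, hy]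
      omega
    · refine PeriodicP1NC.isComplementaryBasis_of_card hs hN heven (T := ![Tx, Ty, Tz]) ?_ ?_ ?_ hψ
      · intro μ
        fin_cases μ
        exacts [hTx, hTy, hTz]
      · intro μ
        fin_cases μ
        · change Tx.card + 1 = N 1 + N 2
          omega
        · change Ty.card + 1 = N 2 + N 0
          omega
        · change Tz.card + 1 = N 0 + N 1
          omega
      · intro i
        rw [Finset.mem_union, Finset.mem_union]
        constructor
        · rintro ((h | h) | h)
          · rw [hsub hTz h]; exact h
          · rw [hsub hTx h]; exact h
          · rw [hsub hTy h]; exact h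
        · generalize (i.2.2 : Fin 3) = μ
          fin_cases μ
          exacts [fun h => Or.inl (Or.inr h), Or.inr, fun h => Or.inl (Or.inl h)]
  · exact PeriodicP1NC.nodeSpace_lt_perSpace hs hN
      (i := ⟨ι, 0, ι + 1, (PeriodicP1NC.ne_add_one ι).symm⟩) heven
  · exact PeriodicP1NC.exists_isAlternating hs heven
  · intro ψ hψ
    refine ⟨?_, PeriodicP1NC.isComplementaryBasis_of_odd hs hN hodd heven hψ⟩
    have hcard : Fintype.card {μ : Fin 3 // μ ≠ ι} = 2 := by simp
    rw [Fintype.card_prod, Fintype.card_fin, hcard, mul_comm]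
  · intro h1 h2
    refine PeriodicP1NC.nodeSpace_eq_perSpace hs hN fun i hi => ?_
    -- An admissible index forces even periods along the two axes other than its own, hence at most
    -- one odd period.
    rcases Nat.even_or_odd (N i.1) with h | h
    · exact h1 fun κ => if hκ : κ = i.1 then hκ ▸ h else hi κ hκ
    · exact h2 ⟨i.1, h, hi⟩
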